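/- **Setting.** Let $K$ be a connected 2-dimensional CW complex with subcomplexes $K_1,K_2,K_3$ such that $K=K_1\cup K_2\cup K_3$ and $K_1\cap K_2\cap K_3=K^1$ is the 1-skeleton. Fix a base point in $K^1$, put $F=\pi_1(K^1)$ and $R_i=\ker(F\to\pi_1(K_i))$, and let $$I_3(F;R_1,R_2,R_3)=\frac{R_1\cap R_2\cap R_3}{[R_1,R_2\cap R_3]\,[R_2,R_3\cap R_1]\,[R_3,R_1\cap R_2]},\qquad [a,b]=a^{-1}b^{-1}ab .$$ Choose for every 2-cell $e$ of $K$ a path in $K^1$ from the base point to the start of its attaching loop, and let $r_e\in F$ be the resulting attaching element. The homotopy groups are described as follows: $\partial:\pi_2(K,K^1)\to F$ is the free crossed module on the 2-cells, i.e. $\pi_2(K,K^1)$ has generators $e^w$ ($e$ a 2-cell, $w\in F$) and relations $e^v\,d^{\,w}\,(e^v)^{-1}=d^{\,v r_e v^{-1}w}$, with $\partial e^w=w r_e w^{-1}$ and $F$-action $v\cdot e^w=e^{vw}$; and $\pi_2(K)=\ker\partial$. The same description, with the 2-cells of $K_j$, gives $\pi_2(K_j)$ and the map $i_j:\pi_2(K_j)\to\pi_2(K)$.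 Write $Q(K)=\pi_2(K)/(i_1\pi_2(K_1)+i_2\pi_2(K_2)+i_3\pi_2(K_3))$. An identity sequence is a finite sequence $c=(c_1,\dots,c_m)$ of terms $c_j=w_j r_{e_j}^{\pm1}w_j^{-1}$ (the cell $e_j$, the sign and $w_j\in F$ are part of the term) with $c_1\cdots c_m=1$ in $F$; it represents the element $\prod_j (e_j^{w_j})^{\pm1}$ of $\pi_2(K)$. Peiffer operations delete or insert two consecutive mutually inverse terms, and replace consecutive $a,b$ by $b,\,b^{-1}ab$ or by $aba^{-1},\,a$. A division of $c$ assigns to each term an index $i\in\{1,2,3\}$ such that its cell lies in $K_i$. Given a division, move the terms of index 1 to the left past all others, and then the terms of index 2 past those of index 3, always by $(a,b)\mapsto(b,b^{-1}ab)$; let $r_c\in R_1$, $s_c\in R_2$, $t_c\in R_3$ be the products of the three resulting blocks, so that $r_cs_ct_c=1$. Let $\bar S$ be the 2-sphere, as the standard complex of $\langle x_1,x_2\mid x_1,\;x_2,\;x_2^{-1}x_1^{-1}\rangle$ with 2-cells $s_1,s_2,s_3$, covered by the subcomplexes $L_i$ formed by the 1-skeleton and $s_i$; thus $I_3(\bar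 S)=I_3(F(x_1,x_2);\langle\langle x_1\rangle\rangle,\langle\langle x_2\rangle\rangle,\langle\langle x_2^{-1}x_1^{-1}\rangle\rangle)=\pi_3(S^2)$, and let $x\in I_3(\bar S)$ be the class of $[x_1,x_2]$. A morphism of covered 2-complexes $K\to L$ consists of a homomorphism $g:\pi_1(K^1)\to\pi_1(L^1)$ that carries each $R_i(K)$ into $R_i(L)$, and a homomorphism $\varphi:\pi_2(K,K^1)\to\pi_2(L,L^1)$ that is compatible with $\partial$ and with the actions along $g$ and carries the image of each $\pi_2(K_i,K^1)$ into the image of $\pi_2(L_i,L^1)$; morphisms $\bar S\to K$ are defined in the same way. A morphism induces maps $I_3(K)\to I_3(L)$ and $Q(K)\to Q(L)$. For a morphism $f=(g,\varphi):\bar S\to K$ let $f_*:I_3(\bar S)\to I_3(F;R_1,R_2,R_3)$ be the induced map and $q(f)\in Q(K)$ the class of $\varphi(s_1s_2s_3)$. **Theorem.** 1. For every divided identity sequence $c$ one has $[r_c,s_c]\in R_1\cap R_2\cap R_3$. If $c,c'$ are divided identity sequences whose underlying sequences are connected by finitely many Peiffer operations, then $[r_c,s_c]$ and $[r_{c'},s_{c'}]$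 have the same class in $I_3(F;R_1,R_2,R_3)$. 2. There is a unique function $\Lambda_x:Q(K)\to I_3(F;R_1,R_2,R_3)$ that sends the class of each divided identity sequence $c$ to the class of $[r_c,s_c]$. 3. $q(f)$ depends only on the homomorphism $g$ underlying $f$, and for each $\alpha\in I_3(\bar S)=\pi_3(S^2)$ there is a unique function $\alpha_*:Q(K)\to I_3(F;R_1,R_2,R_3)$ such that $\alpha_*(q(f))=f_*(\alpha)$ for all morphisms $f:\bar S\to K$. 4. A function $Q(K)\to I_3(F;R_1,R_2,R_3)$ is the function $\Lambda_x$ of part 2 if and only if it is the function $x_*$ of part 3. 5. The functions $\alpha_*$ are natural: they commute with the maps that a morphism $K\to L$ induces on $Q$ and on $I_3$. -/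

import Mathlib

open Topology Metric

universe u v

/-! ### Free crossed modules

For a family of elements `r : A → F` of a group `F`, the free crossed `F`-module on `r` is the group
with generators `e_a^w` (`a : A`, `w : F`) and relations
`e_a^v e_b^w e_a^{-v} = e_b^{v r_a v⁻¹ w}`, together with the boundary map
`∂ e_a^w = w r_a w⁻¹` and the left action of `F` given by `v • e_a^w = e_a^{v w}`. -/

section FreeCrossed

variable {F : Type u} [Group F] {A : Type v}

/-- The Peiffer relators of the free crossed module on `r`. -/
def peifferRelators (r : A → F) : Set (FreeGroup (A × F)) :=
  {x | ∃ (a b : A) (v w : F), x =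
    FreeGroup.of (a, v) * FreeGroup.of (b, w) * (FreeGroup.of (a, v))⁻¹ *
      (FreeGroup.of (b, v * r a * v⁻¹ * w))⁻¹}

/-- The top group of the free crossed module on `r`. For a 2-complex `K` whose 2-cells have
attaching elements `r` in `F = π₁(K¹)`, this is `π₂(K, K¹)`. -/
abbrev FreeCrossed (r : A → F) : Type (max u v) := PresentedGroup (peifferRelators r)

namespace FreeCrossed

/-- The generator `e_a^w`. -/
def gen (r : A → F) (a : A) (w : F) : FreeCrossed r := PresentedGroup.of (a, w)

theorem gen_peiffer (r : A → F) (a b : A) (v w : F) :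
    gen r a v * gen r b w * (gen r a v)⁻¹ * (gen r b (v * r a * v⁻¹ * w))⁻¹ = 1 :=
  PresentedGroup.one_of_mem (rels := peifferRelators r) ⟨a, b, v, w, rfl⟩

/-- The boundary map `e_a^w ↦ w r_a w⁻¹`. -/
def boundary (r : A → F) : FreeCrossed r →* F :=
  PresentedGroup.toGroup (f := fun p : A × F => p.2 * r p.1 * p.2⁻¹) (by
    rintro _ ⟨a, b, v, w, rfl⟩
    simp only [map_mul, map_inv, FreeGroup.lift_apply_of]
    group)

@[simp] theorem boundary_gen (r : A → F) (a : A) (w : F) :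
    boundary r (gen r a w) = w * r a * w⁻¹ :=
  PresentedGroup.toGroup.of _

/-- The action of `g : F`, given by `e_a^w ↦ e_a^{g w}`. -/
def act (r : A → F) (g : F) : FreeCrossed r →* FreeCrossed r :=
  PresentedGroup.toGroup (f := fun p : A × F => gen r p.1 (g * p.2)) (by
    rintro _ ⟨a, b, v, w, rfl⟩
    have h := gen_peiffer r a b (g * v) (g * w)
    have e : g * v * r a * (g * v)⁻¹ * (g * w) = g * (v * r a * v⁻¹ * w) := by group
    rw [e] at h
    simpa only [map_mul, map_inv, FreeGroup.lift_apply_of] using h)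

/-- The map of free crossed modules induced by the inclusion of a set of generators. -/
def incl (r : A → F) (S : Set A) : FreeCrossed (fun a : S => r a) →* FreeCrossed r :=
  PresentedGroup.toGroup (f := fun p : S × F => gen r p.1 p.2) (by
    rintro _ ⟨a, b, v, w, rfl⟩
    have h := gen_peiffer r a b v w
    simpa only [map_mul, map_inv, FreeGroup.lift_apply_of] using h)

theorem boundary_incl (r : A → F) (S : Set A) (c : FreeCrossed (fun a : S => r a)) :
    boundary r (incl r S c) = boundary (fun a : S => r a) c := by
  have : (boundary r).comp (incl r S) = boundary (fun a : S => r a) := by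
    apply PresentedGroup.ext
    rintro ⟨a, w⟩
    have h1 : incl r S (PresentedGroup.of (a, w)) = gen r a w := PresentedGroup.toGroup.of _
    have h2 : boundary (fun a : S => r a) (PresentedGroup.of (a, w)) = w * r a * w⁻¹ :=
      PresentedGroup.toGroup.of _
    rw [MonoidHom.comp_apply, h1, h2, boundary_gen]
  exact DFunLike.congr_fun this c

end FreeCrossed

end FreeCrossed

/-! ### The group `I₃(F; R₁, R₂, R₃)` -/

section IThree

variable {F : Type u} [Group F] {F' : Type v} [Group F']

/-- `R₁ ∩ R₂ ∩ R₃`. -/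
def tripleInter (R : Fin 3 → Subgroup F) : Subgroup F := R 0 ⊓ R 1 ⊓ R 2

/-- `[R₁, R₂ ∩ R₃] [R₂, R₃ ∩ R₁] [R₃, R₁ ∩ R₂]`. -/
def tripleComm (R : Fin 3 → Subgroup F) : Subgroup F :=
  ⁅R 0, R 1 ⊓ R 2⁆ ⊔ ⁅R 1, R 2 ⊓ R 0⁆ ⊔ ⁅R 2, R 0 ⊓ R 1⁆

instance tripleComm_normal (R : Fin 3 → Subgroup F) [∀ i, (R i).Normal] :
    (tripleComm R).Normal := by
  unfold tripleComm; infer_instance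

/-- `I₃(F; R₁, R₂, R₃)`. -/
abbrev IThree (R : Fin 3 → Subgroup F) [∀ i, (R i).Normal] : Type u :=
  tripleInter R ⧸ (tripleComm R).subgroupOf (tripleInter R)

theorem tripleInter_le_comap {R : Fin 3 → Subgroup F} {R' : Fin 3 → Subgroup F'} (g : F →* F')
    (h : ∀ i, R i ≤ (R' i).comap g) : tripleInter R ≤ (tripleInter R').comap g := by
  intro x hx
  exact ⟨⟨h 0 hx.1.1, h 1 hx.1.2⟩, h 2 hx.2⟩

theorem tripleComm_le_comap {R : Fin 3 → Subgroup F} {R' : Fin 3 → Subgroup F'} (g : F →* F')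
    (h : ∀ i, R i ≤ (R' i).comap g) : tripleComm R ≤ (tripleComm R').comap g := by
  have key : ∀ i j k, ⁅R i, R j ⊓ R k⁆ ≤ (⁅R' i, R' j ⊓ R' k⁆).comap g := by
    intro i j k
    rw [← Subgroup.map_le_iff_le_comap, Subgroup.map_commutator]
    refine Subgroup.commutator_mono (Subgroup.map_le_iff_le_comap.2 (h i)) ?_
    exact Subgroup.map_le_iff_le_comap.2 fun x hx => ⟨h j hx.1, h k hx.2⟩
  refine sup_le (sup_le ?_ ?_) ?_
  · exact (key 0 1 2).trans (Subgroup.comap_mono (le_sup_left.trans le_sup_left))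
  · exact (key 1 2 0).trans (Subgroup.comap_mono (le_sup_right.trans le_sup_left))
  · exact (key 2 0 1).trans (Subgroup.comap_mono le_sup_right)

/-- Functoriality of `I₃`. -/
def IThree.map {R : Fin 3 → Subgroup F} [∀ i, (R i).Normal]
    {R' : Fin 3 → Subgroup F'} [∀ i, (R' i).Normal] (g : F →* F')
    (h : ∀ i, R i ≤ (R' i).comap g) : IThree R →* IThree R' :=
  QuotientGroup.map _ _
    ((g.comp (tripleInter R).subtype).codRestrict (tripleInter R')
      fun x => tripleInter_le_comap g h x.2)
    fun _ hx => tripleComm_le_comap g h (Subgroup.mem_subgroupOf.1 hx)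

/-- The commutator `[a, b] = a⁻¹ b⁻¹ a b`. -/
def rcomm (a b : F) : F := a⁻¹ * b⁻¹ * a * b

end IThree

/-! ### Algebraic data of a covered 2-complex -/

/-- The algebraic data extracted from a 2-complex `K` covered by `K₁, K₂, K₃`: the group
`F = π₁(K¹)`, the 2-cells with their attaching elements in `F`, the sets of 2-cells of the `Kᵢ`,
and the kernels `Rᵢ` of `F → π₁(Kᵢ)`. -/
structure TriadData where
  F : Type u
  [group : Group F]
  Cell : Type u
  attach : Cell → F
  sub : Fin 3 → Set Cell
  R : Fin 3 → Subgroup F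
  [normal : ∀ i, (R i).Normal]

namespace TriadData

attribute [instance] TriadData.group TriadData.normal

variable (T : TriadData.{u})

/-- `π₂(K, K¹)`, the free crossed module on the 2-cells of `K`. -/
abbrev C : Type u := FreeCrossed T.attach

/-- `∂ : π₂(K, K¹) → π₁(K¹)`. -/
abbrev bd : T.C →* T.F := FreeCrossed.boundary T.attach

/-- The image of `π₂(Kᵢ, K¹)` in `π₂(K, K¹)`. -/
def relSub (i : Fin 3) : Subgroup T.C := (FreeCrossed.incl T.attach (T.sub i)).range

/-- `π₂(K) = ker ∂`. -/
abbrev piTwo : Subgroup T.C := T.bd.ker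

/-- `iⱼ π₂(Kⱼ)`, the image in `π₂(K)` of the kernel `π₂(Kⱼ)` of `∂ : π₂(Kⱼ, K¹) → π₁(K¹)`. -/
def piTwoSub (j : Fin 3) : Subgroup T.piTwo :=
  ((FreeCrossed.boundary (fun a : T.sub j => T.attach a)).ker.map
    (FreeCrossed.incl T.attach (T.sub j))).subgroupOf T.piTwo

/-- `i₁ π₂(K₁) + i₂ π₂(K₂) + i₃ π₂(K₃)` (written multiplicatively). -/
def piTwoSum : Subgroup T.piTwo := ⨆ j, T.piTwoSub j

/-- `π₂(K) / (i₁ π₂(K₁) + i₂ π₂(K₂) + i₃ π₂(K₃))`. -/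
abbrev PiTwoQuot : Type u := T.piTwo ⧸ T.piTwoSum

/-- `I₃(F; R₁, R₂, R₃)`. -/
abbrev I : Type u := IThree T.R

/-- A morphism of covered 2-complexes, through the morphism that it induces on the crossed modules
`π₂(K, K¹) → π₁(K¹)`; it respects the three subcomplexes. -/
structure Hom (T : TriadData.{u}) (T' : TriadData.{v}) where
  g : T.F →* T'.F
  φ : T.C →* T'.C
  bd_φ : ∀ c, T'.bd (φ c) = g (T.bd c)
  φ_act : ∀ x c, φ (FreeCrossed.act T.attach x c) = FreeCrossed.act T'.attach (g x) (φ c)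
  φ_sub : ∀ i, T.relSub i ≤ (T'.relSub i).comap φ
  g_R : ∀ i, T.R i ≤ (T'.R i).comap g

namespace Hom

variable {T : TriadData.{u}} {T' : TriadData.{v}} (f : Hom T T')

/-- The map `I₃(F; R₁, R₂, R₃) → I₃(F'; R₁', R₂', R₃')` induced by a morphism. -/
def mapI : T.I →* T'.I := IThree.map f.g f.g_R

/-- The map `π₂(K) → π₂(K')` induced by a morphism. -/
def mapPiTwo : T.piTwo →* T'.piTwo :=
  (f.φ.comp T.piTwo.subtype).codRestrict T'.piTwo fun x => by
    have hx : T.bd x.1 = 1 := x.2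
    change T'.bd (f.φ x.1) = 1
    rw [f.bd_φ, hx, map_one]

theorem piTwoSum_le : T.piTwoSum ≤ T'.piTwoSum.comap f.mapPiTwo := by
  refine iSup_le fun j => ?_
  rintro x hx
  obtain ⟨c, hc, hcx⟩ := Subgroup.mem_map.1 (Subgroup.mem_subgroupOf.1 hx)
  refine (le_iSup T'.piTwoSub j : _) (Subgroup.mem_subgroupOf.2 ?_)
  have h1 : f.φ x.1 ∈ T'.relSub j := f.φ_sub j ⟨c, hcx⟩
  obtain ⟨c', hc'⟩ := h1
  refine Subgroup.mem_map.2 ⟨c', ?_, hc'⟩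
  have h2 : T'.bd (f.φ x.1) = 1 := (f.mapPiTwo x).2
  rw [MonoidHom.mem_ker, ← FreeCrossed.boundary_incl, hc']
  exact h2

/-- The map of quotients of second homotopy groups induced by a morphism. -/
def mapPiTwoQuot : T.PiTwoQuot → T'.PiTwoQuot :=
  Quotient.map' f.mapPiTwo fun a b h => by
    rw [QuotientGroup.leftRel_apply] at h ⊢
    simpa using f.piTwoSum_le h

end Hom

/-! ### Identity sequences and Peiffer operations -/

/-- A term `(r_a^{±1})^w = w r_a^{±1} w⁻¹` of a sequence: a conjugate of the attaching element of a
2-cell or of its inverse. -/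
structure Term where
  cell : T.Cell
  conj : T.F
  sign : ℤˣ

namespace Term

variable {T}

/-- The element of `F` that a term denotes. -/
def val (a : T.Term) : T.F := a.conj * T.attach a.cell ^ (a.sign : ℤ) * a.conj⁻¹

/-- The element of `π₂(K, K¹)` that a term denotes. -/
def lift (a : T.Term) : T.C := FreeCrossed.gen T.attach a.cell a.conj ^ (a.sign : ℤ)

/-- The formal inverse of a term. -/
def inv (a : T.Term) : T.Term := ⟨a.cell, a.conj, -a.sign⟩

/-- The formal conjugate `x a x⁻¹` of a term. -/
def conjBy (x : T.F) (a : T.Term) : T.Term := ⟨a.cell, x * a.conj, a.sign⟩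

theorem bd_lift (a : T.Term) : T.bd a.lift = a.val := by
  simp [lift, val, map_zpow, conj_zpow]

end Term

variable {T}

/-- A sequence whose product in `F` is trivial. -/
def IsIdentitySeq (c : List T.Term) : Prop := (c.map Term.val).prod = 1

/-- The element of `π₂(K)` represented by an identity sequence. -/
def seqClass (c : List T.Term) (hc : IsIdentitySeq c) : T.piTwo :=
  ⟨(c.map Term.lift).prod, by
    rw [MonoidHom.mem_ker, map_list_prod, List.map_map]
    have : (T.bd : T.C → T.F) ∘ Term.lift = Term.val := funext Term.bd_lift
    rw [this]
    exact hc⟩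

/-- The Peiffer operations: deletion of two consecutive mutually inverse terms, and the two
exchanges `(a, b) ↦ (b, b⁻¹ a b)` and `(a, b) ↦ (a b a⁻¹, a)`. (Conjugating words are compared as
elements of `F`, and insertion is the reverse of deletion.) -/
inductive PeifferStep : List T.Term → List T.Term → Prop
  | cancel (l₁ l₂ : List T.Term) (a : T.Term) : PeifferStep (l₁ ++ a :: a.inv :: l₂) (l₁ ++ l₂)
  | exchRight (l₁ l₂ : List T.Term) (a b : T.Term) :
      PeifferStep (l₁ ++ a :: b :: l₂) (l₁ ++ b :: Term.conjBy b.val⁻¹ a :: l₂)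
  | exchLeft (l₁ l₂ : List T.Term) (a b : T.Term) :
      PeifferStep (l₁ ++ a :: b :: l₂) (l₁ ++ Term.conjBy a.val b :: a :: l₂)

/-- Peiffer equivalence of sequences. -/
def PeifferEquiv : List T.Term → List T.Term → Prop := Relation.EqvGen PeifferStep

/-- An identity sequence divided into three subsequences: each term carries a label `i`, and a term
labelled `i` comes from a 2-cell of `Kᵢ`. -/
structure DividedSeq (T : TriadData.{u}) where
  terms : List (Fin 3 × T.Term)
  mem_sub : ∀ p ∈ terms, p.2.cell ∈ T.sub p.1
  isIdentity : IsIdentitySeq (terms.map Prod.snd)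

/-- Moves the elements labelled `0` to the left, past the others, and then the elements labelled `1`
past those labelled `2`, by exchanges `(a, b) ↦ (b, b⁻¹ a b)`; returns the products of the three
resulting blocks. Thus, in the first block elements are unchanged; in the second, each one is
conjugated by the product of the elements labelled `0` on its right; in the third, by the product of
the elements labelled `0` on its right and of the new elements of the second block coming from
its right. -/
def blocks {F : Type u} [Group F] : List (Fin 3 × F) → F × F × F
  | [] => (1, 1, 1)
  | (i, x) :: l =>
    let p := blocks l
    if i = 0 then (x * p.1, p.2.1, p.2.2)
    else if i = 1 then (p.1, p.1⁻¹ * x * p.1 * p.2.1, p.2.2)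
    else (p.1, p.2.1, (p.1 * p.2.1)⁻¹ * x * (p.1 * p.2.1) * p.2.2)

namespace DividedSeq

/-- The underlying identity sequence. -/
def seq (c : DividedSeq T) : List T.Term := c.terms.map Prod.snd

/-- The class of the sequence in `π₂(K) / (i₁ π₂(K₁) + i₂ π₂(K₂) + i₃ π₂(K₃))`. -/
def cls (c : DividedSeq T) : T.PiTwoQuot :=
  QuotientGroup.mk (seqClass c.seq c.isIdentity)

/-- The product `r_c`. -/
def r (c : DividedSeq T) : T.F := (blocks (c.terms.map fun p => (p.1, p.2.val))).1

/-- The product `s_c`. -/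
def s (c : DividedSeq T) : T.F := (blocks (c.terms.map fun p => (p.1, p.2.val))).2.1

/-- The product `t_c`. -/
def t (c : DividedSeq T) : T.F := (blocks (c.terms.map fun p => (p.1, p.2.val))).2.2

/-- The element `x` of `I₃(F; R₁, R₂, R₃)` is the class of `[r_c, s_c]`; this includes the
assertion that `[r_c, s_c]` lies in `R₁ ∩ R₂ ∩ R₃`. -/
def IsCommClass (c : DividedSeq T) (x : T.I) : Prop :=
  ∃ h : rcomm c.r c.s ∈ tripleInter T.R, x = QuotientGroup.mk ⟨rcomm c.r c.s, h⟩

end DividedSeq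

end TriadData

/-! ### The 2-sphere -/

/-- The relators `x₁, x₂, x₂⁻¹ x₁⁻¹`. -/
def sphereRelator : Fin 3 → FreeGroup (Fin 2) :=
  ![FreeGroup.of 0, FreeGroup.of 1, (FreeGroup.of 1)⁻¹ * (FreeGroup.of 0)⁻¹]

/-- The data of the 2-sphere as the standard complex of `⟨x₁, x₂ | x₁, x₂, x₂⁻¹ x₁⁻¹⟩`, covered by
the three subcomplexes `Lᵢ` that consist of the 1-skeleton and the `i`-th 2-cell. The kernel of
`F(x₁, x₂) → π₁(Lᵢ)` is the normal closure of the `i`-th relator. -/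
def sphereData : TriadData.{0} where
  F := FreeGroup (Fin 2)
  Cell := Fin 3
  attach := sphereRelator
  sub i := {i}
  R i := Subgroup.normalClosure {sphereRelator i}

/-- The generator of `π₂(S²)`: the product of the three 2-cells. -/
def sphereGen : sphereData.piTwo :=
  ⟨FreeCrossed.gen sphereRelator 0 1 * FreeCrossed.gen sphereRelator 1 1 *
      FreeCrossed.gen sphereRelator 2 1, by
    change FreeCrossed.boundary sphereRelator _ = 1
    rw [map_mul, map_mul, FreeCrossed.boundary_gen, FreeCrossed.boundary_gen,
      FreeCrossed.boundary_gen]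
    simp [sphereRelator, mul_assoc]⟩

/-- The commutator `[x₁, x₂]`. -/
def sphereComm : FreeGroup (Fin 2) := rcomm (FreeGroup.of 0) (FreeGroup.of 1)

theorem sphereComm_mem : sphereComm ∈ tripleInter sphereData.R := by
  have hR : ∀ i, sphereRelator i ∈ Subgroup.normalClosure {sphereRelator i} :=
    fun i => Subgroup.subset_normalClosure rfl
  have hn : ∀ i, (Subgroup.normalClosure {sphereRelator i}).Normal :=
    fun i => Subgroup.normalClosure_normal
  suffices h : ∀ i, sphereComm ∈ Subgroup.normalClosure {sphereRelator i} from
    ⟨⟨h 0, h 1⟩, h 2⟩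
  intro i
  fin_cases i
  · have h := mul_mem (inv_mem (hR 0)) ((hn 0).conj_mem _ (hR 0) (FreeGroup.of 1)⁻¹)
    simpa [sphereRelator, sphereComm, rcomm, mul_assoc] using h
  · have h := mul_mem ((hn 1).conj_mem _ (inv_mem (hR 1)) (FreeGroup.of 0)⁻¹) (hR 1)
    simpa [sphereRelator, sphereComm, rcomm, mul_assoc] using h
  · have h := mul_mem ((hn 2).conj_mem _ (hR 2) (FreeGroup.of 0)⁻¹) (inv_mem (hR 2))
    simpa [sphereRelator, sphereComm, rcomm, mul_assoc] using h

/-- The generator `[x₁, x₂]` of `π₃(S²) = I₃(F(x₁, x₂); ⟨x₁⟩, ⟨x₂⟩, ⟨x₂⁻¹ x₁⁻¹⟩)`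
(normal closures). -/
def hopfClass : sphereData.I := QuotientGroup.mk ⟨sphereComm, sphereComm_mem⟩

/-! ### Covered 2-complexes -/

/-- The loop `t ↦ v / ‖v‖`, `v = (cos 2πt, sin 2πt)`, that runs once around the boundary of the square
`[-1, 1]²`, which is the closed unit ball of `Fin 2 → ℝ`. -/
noncomputable def squareLoop (t : ℝ) : Fin 2 → ℝ :=
  ‖![Real.cos (2 * Real.pi * t), Real.sin (2 * Real.pi * t)]‖⁻¹ •
    ![Real.cos (2 * Real.pi * t), Real.sin (2 * Real.pi * t)]

theorem squareLoop_aux (x : ℝ) : ![Real.cos x, Real.sin x] ≠ 0 := by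
  intro h
  have h0 : Real.cos x = 0 := congrFun h 0
  have h1 : Real.sin x = 0 := congrFun h 1
  have := Real.sin_sq_add_cos_sq x
  simp [h0, h1] at this

theorem squareLoop_mem (t : ℝ) : squareLoop t ∈ sphere (0 : Fin 2 → ℝ) 1 := by
  rw [mem_sphere_zero_iff_norm, squareLoop, norm_smul, norm_inv, norm_norm]
  exact inv_mul_cancel₀ (norm_ne_zero_iff.2 (squareLoop_aux _))

theorem squareLoop_continuous : Continuous squareLoop := by
  have h : Continuous fun t : ℝ =>
      ![Real.cos (2 * Real.pi * t), Real.sin (2 * Real.pi * t)] := by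
    refine continuous_pi fun i => ?_
    fin_cases i <;> simp <;> fun_prop
  exact (h.norm.inv₀ fun t => norm_ne_zero_iff.2 (squareLoop_aux _)).smul h

theorem squareLoop_one : squareLoop 1 = squareLoop 0 := by simp [squareLoop]

section Boundary

open RelCWComplex

variable {X : Type u} [TopologicalSpace X] [T2Space X] [CWComplex (Set.univ : Set X)]

/-- The 1-skeleton, as a topological space. -/
abbrev OneSkeleton (X : Type u) [TopologicalSpace X] [T2Space X] [CWComplex (Set.univ : Set X)] :
    Type u :=
  (skeleton (Set.univ : Set X) 1 : Set X)

/-- The point at time `t` of the attaching loop of a 2-cell. -/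
noncomputable def boundaryPoint (e : cell (Set.univ : Set X) 2) (t : ℝ) : OneSkeleton X :=
  ⟨map 2 e (squareLoop t), by
    have h := cellFrontier_subset_skeleton (C := (Set.univ : Set X)) 1 e
    exact_mod_cast h ⟨_, squareLoop_mem t, rfl⟩⟩

/-- The attaching loop of a 2-cell, in the 1-skeleton. -/
noncomputable def attachLoop (e : cell (Set.univ : Set X) 2) :
    Path (boundaryPoint e 0) (boundaryPoint e 0) where
  toFun t := boundaryPoint e t
  continuous_toFun := by
    refine Continuous.subtype_mk ?_ _
    exact (continuousOn 2 e).comp_continuous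
      (squareLoop_continuous.comp continuous_subtype_val)
      fun t => sphere_subset_closedBall (squareLoop_mem _)
  source' := by simp
  target' := by
    apply Subtype.ext
    simp [boundaryPoint, squareLoop_one]

end Boundary

/-- A connected 2-dimensional CW complex `K` with subcomplexes `K₁, K₂, K₃` such that
`K = K₁ ∪ K₂ ∪ K₃` and `K₁ ∩ K₂ ∩ K₃` is the 1-skeleton `K¹`, together with the auxiliary choices that
are needed to describe `π₂(K, K¹)`: a base point in `K¹` and, for each 2-cell, a path in `K¹`
from the base point to the start of the attaching loop of the cell. -/
structure CoveredTwoComplex where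
  X : Type u
  [top : TopologicalSpace X]
  [t2 : T2Space X]
  [conn : ConnectedSpace X]
  [cw : CWComplex (Set.univ : Set X)]
  dim_le_two : ∀ n, 2 < n → IsEmpty (RelCWComplex.cell (Set.univ : Set X) n)
  sub : Fin 3 → RelCWComplex.Subcomplex (Set.univ : Set X)
  union_eq : ⋃ i, (sub i : Set X) = Set.univ
  inter_eq : ⋂ i, (sub i : Set X) = RelCWComplex.skeleton (Set.univ : Set X) 1
  base : OneSkeleton X
  tail : ∀ e : RelCWComplex.cell (Set.univ : Set X) 2, Path base (boundaryPoint e 0)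

namespace CoveredTwoComplex

attribute [instance] CoveredTwoComplex.top CoveredTwoComplex.t2 CoveredTwoComplex.conn
  CoveredTwoComplex.cw

variable (K : CoveredTwoComplex.{u})

/-- `π₁(K¹)`. -/
abbrev piOne : Type u := FundamentalGroup (OneSkeleton K.X) K.base

/-- The attaching element of a 2-cell in `π₁(K¹)`: run through the chosen path, then through the
attaching loop, then back. -/
noncomputable def attach (e : RelCWComplex.cell (Set.univ : Set K.X) 2) : K.piOne :=
  FundamentalGroup.fromPath
    (Path.Homotopic.Quotient.mk (((K.tail e).trans (attachLoop e)).trans (K.tail e).symm))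

/-- The inclusion `K¹ → Kᵢ`. -/
def inclusion (i : Fin 3) : C(OneSkeleton K.X, (K.sub i : Set K.X)) :=
  ContinuousMap.inclusion (by
    rw [← K.inter_eq]
    exact Set.iInter_subset _ i)

/-- The data of `K`: `F = π₁(K¹)`, the 2-cells of `K` and of the `Kᵢ`, and
`Rᵢ = ker (π₁(K¹) → π₁(Kᵢ))`. -/
noncomputable def data : TriadData.{u} where
  F := K.piOne
  Cell := RelCWComplex.cell (Set.univ : Set K.X) 2
  attach := K.attach
  sub i := (K.sub i).I 2
  R i := (FundamentalGroup.map (K.inclusion i) K.base).ker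

end CoveredTwoComplex

namespace TriadData

/-- The map `q` on morphisms from the 2-sphere: the class of the image of the generator of
`π₂(S²)`. -/
def Hom.q {T : TriadData.{u}} (f : Hom sphereData T) : T.PiTwoQuot :=
  f.mapPiTwoQuot (QuotientGroup.mk sphereGen)

/-- The function `αs` makes the triangle of `α` commute: `αs (q f) = f_* α` for every morphism `f`
from the 2-sphere. -/
def IsInduced {T : TriadData.{u}} (α : sphereData.I) (αs : T.PiTwoQuot → T.I) : Prop :=
  ∀ f : Hom sphereData T, αs f.q = f.mapI α

/-- The function `Λ` sends the class of a divided identity sequence `c` to `[r_c, s_c]`. -/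
def IsLambda {T : TriadData.{u}} (Λ : T.PiTwoQuot → T.I) : Prop :=
  ∀ c : DividedSeq T, c.IsCommClass (Λ c.cls)

end TriadData

/-!
Everything is reduced to group theory. The topology enters only through
`CoveredTwoComplex.data_isCovered`: each 2-cell belongs to some `Kᵢ`, and the attaching loop of a
cell of `Kᵢ` bounds a disc in `Kᵢ`, so that its attaching element lies in `Rᵢ`.

Sorting sequences of labelled elements into three blocks is multiplication in the iterated
semidirect product `R₁ ⋉ (R₂ ⋉ R₃)` (`BlockTriple`, `BlockTriple.blockGroup`), from which
`(r, s, t) ↦ r s t` is a homomorphism to `F`. For triples with `r s t = 1` the commutator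
`[r, s]` lies in all `Rᵢ`, and its class modulo
`J = [R₁, R₂ ∩ R₃] [R₂, R₃ ∩ R₁] [R₃, R₁ ∩ R₂]` is invariant under conjugation by triples
and under moving an element of `Rᵢ ∩ Rⱼ` from the `i`-th block to the `j`-th. The triples that
can be multiplied to such a triple without changing the class form a normal subgroup
(`BlockTriple.negligible`). Modulo this subgroup the choice of labels is immaterial
(`singleQuot_eq`) and the Peiffer relations hold (`singleQuot_conj`), so sorting becomes a
homomorphism on the free crossed module `π₂(K, K¹)` (`IsCovered.sort`). On the image of
`π₂(Kᵢ, K¹)` it factors through the boundary map, so it kills `π₂(Kᵢ)`. Therefore `[r, s]` induces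
a function `Λₓ` on `Q(K)` (`IsCovered.lambda`); since every class in `Q(K)` contains a divided
identity sequence, it is unique. Peiffer equivalent sequences represent the same element of
`π₂(K)` (`PeifferEquiv.prod_lift_eq`).

A morphism from the sphere to `K` amounts to a triple of elements `yᵢ` of the images of the
`π₂(Kᵢ, K¹)` with `∂(y₁ y₂ y₃) = 1`. These images are normal subgroups that generate `π₂(K, K¹)`,
so every class in `Q(K)` is of the form `q(f)` (`Hom.q_surjective`), which gives the uniqueness of
`α_*` and its naturality. If `g` is given, so are the `∂ yᵢ`, hence each `yᵢ` is determined up to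
the central subgroup that is the image of `π₂(Kᵢ)`, and `q(f)` is determined
(`Hom.q_eq_of_g_eq`). The triple of the `∂ yᵢ` represents `y₁ y₂ y₃`, so `f_* x = Λₓ(q(f))`
(`Hom.mapI_hopfClass`). Finally, `x` generates `I₃` of the sphere (`exists_hopfClass_zpow`), hence
if `α = xⁿ`, then `f_* α = Λₓ(q(f))ⁿ` depends only on `q(f)`.
-/

universe w

/-! ### Triples of blocks -/

/-- The iterated semidirect product `F ⋉ (F ⋉ F)` for the conjugation actions. The triple
`(r, s, t)` stands for a sequence of elements that has been sorted into three blocks with products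
`r`, `s` and `t`; multiplying two triples means sorting their concatenation by the exchanges
`(a, b) ↦ (b, b⁻¹ a b)`. -/
@[ext] structure BlockTriple (F : Type u) where
  r : F
  s : F
  t : F

namespace BlockTriple

variable {F : Type u} [Group F]

instance : Mul (BlockTriple F) :=
  ⟨fun p q => ⟨p.r * q.r, q.r⁻¹ * p.s * q.r * q.s, (q.r * q.s)⁻¹ * p.t * (q.r * q.s) * q.t⟩⟩

instance : One (BlockTriple F) := ⟨⟨1, 1, 1⟩⟩

instance : Inv (BlockTriple F) :=
  ⟨fun p => ⟨p.r⁻¹, p.r * p.s⁻¹ * p.r⁻¹, p.r * p.s * p.t⁻¹ * p.s⁻¹ * p.r⁻¹⟩⟩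

@[simp] theorem mul_r (p q : BlockTriple F) : (p * q).r = p.r * q.r := rfl
@[simp] theorem mul_s (p q : BlockTriple F) : (p * q).s = q.r⁻¹ * p.s * q.r * q.s := rfl
@[simp] theorem mul_t (p q : BlockTriple F) :
    (p * q).t = (q.r * q.s)⁻¹ * p.t * (q.r * q.s) * q.t := rfl
@[simp] theorem one_r : (1 : BlockTriple F).r = 1 := rfl
@[simp] theorem one_s : (1 : BlockTriple F).s = 1 := rfl
@[simp] theorem one_t : (1 : BlockTriple F).t = 1 := rfl
@[simp] theorem inv_r (p : BlockTriple F) : p⁻¹.r = p.r⁻¹ := rfl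
@[simp] theorem inv_s (p : BlockTriple F) : p⁻¹.s = p.r * p.s⁻¹ * p.r⁻¹ := rfl
@[simp] theorem inv_t (p : BlockTriple F) :
    p⁻¹.t = p.r * p.s * p.t⁻¹ * p.s⁻¹ * p.r⁻¹ := rfl

instance : Group (BlockTriple F) :=
  Group.ofLeftAxioms
    (fun p q l => by ext <;> simp [mul_assoc])
    (fun p => by ext <;> simp)
    (fun p => by ext <;> simp [mul_assoc])

/-- The product of the three blocks. -/
def total : BlockTriple F →* F where
  toFun p := p.r * p.s * p.t
  map_one' := by simp
  map_mul' p q := by simp [mul_assoc]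

theorem total_apply (p : BlockTriple F) : total p = p.r * p.s * p.t := rfl

/-- The sequence with the single entry `x`, which is put into the block `i`. -/
def single (i : Fin 3) : F →* BlockTriple F where
  toFun x := ![⟨x, 1, 1⟩, ⟨1, x, 1⟩, ⟨1, 1, x⟩] i
  map_one' := by fin_cases i <;> rfl
  map_mul' x y := by fin_cases i <;> ext <;> simp

@[simp] theorem single_zero (x : F) : single 0 x = ⟨x, 1, 1⟩ := rfl
@[simp] theorem single_one (x : F) : single 1 x = ⟨1, x, 1⟩ := rfl
@[simp] theorem single_two (x : F) : single 2 x = ⟨1, 1, x⟩ := rfl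

@[simp] theorem total_single (i : Fin 3) (x : F) : total (single i x) = x := by
  fin_cases i <;> simp [total_apply]

/-- The triples whose `i`-th entry lies in `R i`. -/
def blockGroup (R : Fin 3 → Subgroup F) [∀ i, (R i).Normal] : Subgroup (BlockTriple F) where
  carrier := {p | p.r ∈ R 0 ∧ p.s ∈ R 1 ∧ p.t ∈ R 2}
  one_mem' := ⟨one_mem _, one_mem _, one_mem _⟩
  mul_mem' {p q} hp hq := by
    refine ⟨mul_mem hp.1 hq.1, mul_mem ?_ hq.2.1, mul_mem ?_ hq.2.2⟩
    · simpa using (inferInstance : (R 1).Normal).conj_mem _ hp.2.1 q.r⁻¹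
    · simpa using (inferInstance : (R 2).Normal).conj_mem _ hp.2.2 (q.r * q.s)⁻¹
  inv_mem' {p} hp := by
    refine ⟨inv_mem hp.1, (inferInstance : (R 1).Normal).conj_mem _ (inv_mem hp.2.1) p.r, ?_⟩
    simpa [mul_assoc] using (inferInstance : (R 2).Normal).conj_mem _ (inv_mem hp.2.2) (p.r * p.s)

variable {R : Fin 3 → Subgroup F} [∀ i, (R i).Normal]

theorem single_mem {i : Fin 3} {x : F} (hx : x ∈ R i) : single i x ∈ blockGroup R := by
  fin_cases i
  · exact ⟨hx, one_mem _, one_mem _⟩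
  · exact ⟨one_mem _, hx, one_mem _⟩
  · exact ⟨one_mem _, one_mem _, hx⟩

theorem eq_single_mul (p : BlockTriple F) :
    p = single 0 p.r * single 1 p.s * single 2 p.t := by
  ext <;> simp

/-- If `r s t = 1`, then `[r, s] = r⁻¹ (s⁻¹ r s) = (r⁻¹ s⁻¹ r) s = (r⁻¹ t r) t⁻¹` lies in all three
subgroups. -/
theorem rcomm_mem_tripleInter {p : BlockTriple F} (hp : p ∈ blockGroup R) (h : total p = 1) :
    rcomm p.r p.s ∈ tripleInter R := by
  obtain ⟨hr, hs, ht⟩ := hp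
  have hn : ∀ i, (R i).Normal := inferInstance
  refine ⟨⟨?_, ?_⟩, ?_⟩
  · have := mul_mem (inv_mem hr) ((hn 0).conj_mem _ hr p.s⁻¹)
    simpa [rcomm, mul_assoc] using this
  · have := mul_mem ((hn 1).conj_mem _ (inv_mem hs) p.r⁻¹) hs
    simpa [rcomm, mul_assoc] using this
  · have e : p.t = p.s⁻¹ * p.r⁻¹ := by
      rw [total_apply, mul_eq_one_iff_inv_eq] at h
      rw [← h]; group
    have := mul_mem ((hn 2).conj_mem _ ht p.r⁻¹) (inv_mem ht)
    rw [e] at this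
    simpa [rcomm, mul_assoc] using this

end BlockTriple

/-! ### The commutator of the first two blocks -/

section Commutators

variable {G : Type u} [Group G] {r s u : G}

theorem rcomm_mul_inv_mul (h : Commute u (r * s)) (hc : Commute u (rcomm r s)) :
    rcomm (r * u) (u⁻¹ * s) = rcomm r s :=
  calc rcomm (r * u) (u⁻¹ * s) = u⁻¹ * r⁻¹ * s⁻¹ * (u * (r * s)) := by simp [rcomm, mul_assoc]
    _ = u⁻¹ * (rcomm r s * u) := by rw [h.eq]; simp [rcomm, mul_assoc]
    _ = rcomm r s := by rw [← hc.eq]; simp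

theorem rcomm_mul_conj (h : Commute u s) (hc : Commute u (rcomm r s)) :
    rcomm (r * u) (u⁻¹ * s * u) = rcomm r s :=
  calc rcomm (r * u) (u⁻¹ * s * u) = u⁻¹ * r⁻¹ * (u⁻¹ * (u * s))⁻¹ * r * (u * (u⁻¹ * (s * u))) := by
        rw [mul_assoc u⁻¹ s u, ← h.eq]; simp [rcomm, mul_assoc, h.eq]
    _ = u⁻¹ * (rcomm r s * u) := by simp [rcomm, mul_assoc]
    _ = rcomm r s := by rw [← hc.eq]; simp

theorem rcomm_mul_right (h : Commute u r) (hc : Commute u (rcomm r s)) :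
    rcomm r (s * u) = rcomm r s :=
  calc rcomm r (s * u) = (u * r)⁻¹ * s⁻¹ * r * s * u := by simp [rcomm, mul_assoc]
    _ = u⁻¹ * (rcomm r s * u) := by rw [h.eq]; simp [rcomm, mul_assoc]
    _ = rcomm r s := by rw [← hc.eq]; simp

theorem rcomm_conj_right {y : G} (h : Commute (rcomm r y) (r * s)) (hr : Commute r (rcomm r s))
    (hy : Commute y (rcomm r s)) :
    rcomm r (r⁻¹ * y * r * s * y⁻¹) = rcomm r s := by
  have e1 : r * s * rcomm r y = rcomm r y * (r * s) := h.eq.symm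
  calc rcomm r (r⁻¹ * y * r * s * y⁻¹)
      = r⁻¹ * y * (r * s)⁻¹ * r * (rcomm r y * (r * s)) * y⁻¹ := by
        simp [rcomm, mul_assoc]
    _ = r⁻¹ * y * (r * s)⁻¹ * r * (r * s) * rcomm r y * y⁻¹ := by rw [← e1]; simp [mul_assoc]
    _ = r⁻¹ * y * (r * rcomm r s * r⁻¹) * y⁻¹ * r := by simp [rcomm, mul_assoc]
    _ = r⁻¹ * (y * rcomm r s) * y⁻¹ * r := by rw [hr.eq]; simp [mul_assoc]
    _ = r⁻¹ * (rcomm r s * r) := by rw [hy.eq]; simp [mul_assoc]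
    _ = rcomm r s := by rw [← hr.eq]; simp

theorem map_rcomm {H : Type v} [Group H] (f : G →* H) (a b : G) :
    f (rcomm a b) = rcomm (f a) (f b) := by
  simp [rcomm]

end Commutators

section TripleComm

variable {F : Type u} [Group F] (R : Fin 3 → Subgroup F) [∀ i, (R i).Normal]

/-- The projection of `F` onto its quotient by `[R₁, R₂ ∩ R₃] [R₂, R₃ ∩ R₁] [R₃, R₁ ∩ R₂]`. -/
abbrev modTripleComm : F →* F ⧸ tripleComm R := QuotientGroup.mk' (tripleComm R)

variable {R}

open scoped commutatorElement in
theorem commute_modTripleComm {a b : F} (h : ⁅a, b⁆ ∈ tripleComm R) :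
    Commute (modTripleComm R a) (modTripleComm R b) := by
  rw [← commutatorElement_eq_one_iff_commute, ← map_commutatorElement]
  exact (QuotientGroup.eq_one_iff _).2 h

theorem commute_of_mem_zero {a b : F} (ha : a ∈ R 0) (hb : b ∈ R 1 ⊓ R 2) :
    Commute (modTripleComm R a) (modTripleComm R b) :=
  commute_modTripleComm <| Subgroup.mem_sup_left <| Subgroup.mem_sup_left <|
    Subgroup.commutator_mem_commutator ha hb

theorem commute_of_mem_one {a b : F} (ha : a ∈ R 1) (hb : b ∈ R 2 ⊓ R 0) :
    Commute (modTripleComm R a) (modTripleComm R b) :=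
  commute_modTripleComm <| Subgroup.mem_sup_left <| Subgroup.mem_sup_right <|
    Subgroup.commutator_mem_commutator ha hb

theorem commute_of_mem_two {a b : F} (ha : a ∈ R 2) (hb : b ∈ R 0 ⊓ R 1) :
    Commute (modTripleComm R a) (modTripleComm R b) :=
  commute_modTripleComm <| Subgroup.mem_sup_right <|
    Subgroup.commutator_mem_commutator ha hb

theorem commute_tripleInter {i : Fin 3} {a b : F} (ha : a ∈ R i) (hb : b ∈ tripleInter R) :
    Commute (modTripleComm R a) (modTripleComm R b) := by
  obtain ⟨⟨h0, h1⟩, h2⟩ := hb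
  fin_cases i
  · exact commute_of_mem_zero ha ⟨h1, h2⟩
  · exact commute_of_mem_one ha ⟨h2, h0⟩
  · exact commute_of_mem_two ha ⟨h0, h1⟩

end TripleComm

namespace BlockTriple

variable {F : Type u} [Group F] {R : Fin 3 → Subgroup F} [∀ i, (R i).Normal]

variable (R) in
/-- The class of `[r, s]` modulo `[R₁, R₂ ∩ R₃] [R₂, R₃ ∩ R₁] [R₃, R₁ ∩ R₂]`. -/
def commClass (p : BlockTriple F) : F ⧸ tripleComm R := modTripleComm R (rcomm p.r p.s)

theorem mul_mem_two {p : BlockTriple F} (hp : p ∈ blockGroup R) (h : total p = 1) :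
    p.r * p.s ∈ R 2 := by
  rw [total_apply, mul_eq_one_iff_eq_inv] at h
  rw [h]; exact inv_mem hp.2.2

theorem commute_commClass {i : Fin 3} {x : F} (hx : x ∈ R i) {p : BlockTriple F}
    (hp : p ∈ blockGroup R) (h : total p = 1) :
    Commute (modTripleComm R x)
      (rcomm (modTripleComm R p.r) (modTripleComm R p.s)) := by
  rw [← map_rcomm]
  exact commute_tripleInter hx (rcomm_mem_tripleInter hp h)

/-- Moving an element of `R i ∩ R j` from one block to another does not change the class of
`[r, s]`. -/
theorem commClass_mul_single {i j : Fin 3} {x : F} (hi : x ∈ R i) (hj : x ∈ R j)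
    {p : BlockTriple F} (hp : p ∈ blockGroup R) (h : total p = 1) (hij : i < j) :
    commClass R (p * (single i x * (single j x)⁻¹)) = commClass R p := by
  have hc := commute_commClass hi hp h
  fin_cases i <;> fin_cases j <;> simp at hij
  · have := commute_of_mem_two (mul_mem_two hp h) ⟨hi, hj⟩
    rw [map_mul] at this
    simpa [commClass, map_rcomm] using rcomm_mul_inv_mul this.symm hc
  · have := commute_of_mem_one hp.2.1 ⟨hj, hi⟩
    simpa [commClass, map_rcomm] using rcomm_mul_conj this.symm hc
  · have := commute_of_mem_zero hp.1 ⟨hi, hj⟩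
    simpa [commClass, map_rcomm] using rcomm_mul_right this.symm hc

/-- The class of `[r, s]` is invariant under conjugation. -/
theorem commClass_conj_single {i : Fin 3} {x : F} (hi : x ∈ R i)
    {p : BlockTriple F} (hp : p ∈ blockGroup R) (h : total p = 1) :
    commClass R (single i x * p * (single i x)⁻¹) = commClass R p := by
  have hc := commute_commClass hi hp h
  fin_cases i
  · have e : commClass R (single 0 x * p * (single 0 x)⁻¹) =
        modTripleComm R x * modTripleComm R (rcomm p.r p.s) * (modTripleComm R x)⁻¹ := by
      simp [commClass, rcomm, mul_assoc]
    refine e.trans ?_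
    rw [map_rcomm, hc.eq, mul_inv_cancel_right, ← map_rcomm, commClass]
  · have hn : ∀ i, (R i).Normal := inferInstance
    have hxr : rcomm p.r x ∈ R 0 ⊓ R 1 := by
      constructor
      · have := mul_mem (inv_mem hp.1) ((hn 0).conj_mem _ hp.1 x⁻¹)
        simpa [rcomm, mul_assoc] using this
      · have := mul_mem ((hn 1).conj_mem _ (inv_mem hi) p.r⁻¹) hi
        simpa [rcomm, mul_assoc] using this
    have h1 := commute_of_mem_two (mul_mem_two hp h) hxr
    rw [map_rcomm, map_mul] at h1
    have := rcomm_conj_right h1.symm (commute_commClass hp.1 hp h) hc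
    simpa [commClass, map_rcomm] using this
  · simp [commClass]

variable (R) in
/-- The triples of total product `1` by which a triple of total product `1` can be multiplied
without changing the class of `[r, s]`. -/
def negligible : Subgroup (blockGroup R) where
  carrier := {n | total n.1 = 1 ∧ ∀ p : blockGroup R, total p.1 = 1 →
    commClass R (p * n).1 = commClass R p.1}
  one_mem' := ⟨map_one _, fun p _ => by rw [mul_one]⟩
  mul_mem' {m n} hm hn := by
    refine ⟨by simp [hm.1, hn.1], fun p hp => ?_⟩
    rw [← mul_assoc, hn.2 (p * m) (by simp [hp, hm.1]), hm.2 p hp]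
  inv_mem' {n} hn := by
    refine ⟨by simp [hn.1], fun p hp => ?_⟩
    rw [← hn.2 (p * n⁻¹) (by simp [hp, hn.1]), inv_mul_cancel_right]

theorem mem_negligible {n : blockGroup R} : n ∈ negligible R ↔ total n.1 = 1 ∧
    ∀ p : blockGroup R, total p.1 = 1 → commClass R (p * n).1 = commClass R p.1 := Iff.rfl

theorem commClass_conj (g : blockGroup R) {p : blockGroup R} (h : total p.1 = 1) :
    commClass R (g * p * g⁻¹).1 = commClass R p.1 := by
  have key : ∀ {i : Fin 3} {x : F} (_ : x ∈ R i) {q : BlockTriple F}, q ∈ blockGroup R →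
      total q = 1 → single i x * q * (single i x)⁻¹ ∈ blockGroup R ∧
        total (single i x * q * (single i x)⁻¹) = 1 ∧
        commClass R (single i x * q * (single i x)⁻¹) = commClass R q := fun hi q hq h =>
    ⟨mul_mem (mul_mem (single_mem hi) hq) (inv_mem (single_mem hi)), by simp [h],
      commClass_conj_single hi hq h⟩
  obtain ⟨a2, b2, c2⟩ := key g.2.2.2 p.2 h
  obtain ⟨a1, b1, c1⟩ := key g.2.2.1 a2 b2
  obtain ⟨a0, b0, c0⟩ := key g.2.1 a1 b1
  rw [← c2, ← c1, ← c0]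
  congr 1
  have := eq_single_mul g.1
  change g.1 * p.1 * g.1⁻¹ = _
  rw [this]
  simp only [mul_assoc, mul_inv_rev]
  simp

instance negligible_normal : (negligible R).Normal := by
  refine ⟨fun n hn g => ⟨by simp [hn.1], fun p hp => ?_⟩⟩
  have h1 : total (g⁻¹ * p * g).1 = 1 := by simp [hp]
  have h2 : total (g⁻¹ * p * g * n).1 = 1 := by
    rw [Subgroup.coe_mul, map_mul, h1, hn.1, one_mul]
  have e : p * (g * n * g⁻¹) = g * (g⁻¹ * p * g * n) * g⁻¹ := by group
  have e' : p = g * (g⁻¹ * p * g) * g⁻¹ := by group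
  rw [e, commClass_conj g h2, hn.2 _ h1]
  conv_rhs => rw [e', commClass_conj g h1]

variable (R) in
/-- The group of triples modulo the negligible ones. -/
abbrev BlockQuot : Type u := blockGroup R ⧸ negligible R

/-- The class of the sequence with the single entry `x`, put into the block `i`. -/
def singleQuot (i : Fin 3) : R i →* BlockQuot R :=
  (QuotientGroup.mk' _).comp
    (((single i).comp (R i).subtype).codRestrict (blockGroup R) fun x => single_mem x.2)

theorem singleQuot_apply {i : Fin 3} {x : F} (hx : x ∈ R i) :
    singleQuot i ⟨x, hx⟩ = QuotientGroup.mk (⟨single i x, single_mem hx⟩ : blockGroup R) := rfl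

theorem singleQuot_eq {i j : Fin 3} {x : F} (hi : x ∈ R i) (hj : x ∈ R j) :
    singleQuot i ⟨x, hi⟩ = singleQuot j ⟨x, hj⟩ := by
  wlog hij : i < j generalizing i j
  · rcases (not_lt.1 hij).eq_or_lt with rfl | h
    · rfl
    · exact (this hj hi h).symm
  rw [singleQuot_apply, singleQuot_apply, ← mul_inv_eq_one, ← QuotientGroup.mk_inv,
    ← QuotientGroup.mk_mul, QuotientGroup.eq_one_iff, mem_negligible]
  exact ⟨by simp, fun p hp => commClass_mul_single hi hj p.2 hp hij⟩

/-- Both sides of the Peiffer relation become equal once triples are taken modulo the negligible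
ones. -/
theorem singleQuot_conj {i j : Fin 3} {x y : F} (hx : x ∈ R i) (hy : y ∈ R j)
    (hxy : x * y * x⁻¹ ∈ R j) :
    singleQuot i ⟨x, hx⟩ * singleQuot j ⟨y, hy⟩ * (singleQuot i ⟨x, hx⟩)⁻¹ =
      singleQuot j ⟨x * y * x⁻¹, hxy⟩ := by
  -- When the block `i` is not to the right of the block `j`, the relation holds for triples.
  have low : ∀ {i j : Fin 3} {x y : F} (hx : x ∈ R i) (hy : y ∈ R j) (hxy : x * y * x⁻¹ ∈ R j),
      i ≤ j → singleQuot i ⟨x, hx⟩ * singleQuot j ⟨y, hy⟩ * (singleQuot i ⟨x, hx⟩)⁻¹ =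
        singleQuot j ⟨x * y * x⁻¹, hxy⟩ := by
    intro i j x y hx hy hxy hij
    simp only [singleQuot_apply, ← QuotientGroup.mk_mul, ← QuotientGroup.mk_inv]
    congr 1
    apply Subtype.ext
    change single i x * single j y * (single i x)⁻¹ = single j (x * y * x⁻¹)
    fin_cases i <;> fin_cases j <;> simp at hij <;> ext <;> simp [mul_assoc]
  rcases le_or_gt i j with hij | hij
  · exact low hx hy hxy hij
  -- Otherwise apply it to the conjugate of `x⁻¹` by `y`, and put `x y x⁻¹ y⁻¹`, which lies in both
  -- subgroups, into the other block.
  have hn : ∀ i, (R i).Normal := inferInstance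
  have hz : y * x⁻¹ * y⁻¹ ∈ R i := (hn i).conj_mem _ (inv_mem hx) y
  have h1 := low hy (inv_mem hx) hz hij.le
  have hci : x * (y * x⁻¹ * y⁻¹) ∈ R i := mul_mem hx hz
  have hcj : x * (y * x⁻¹ * y⁻¹) ∈ R j := by
    simpa [mul_assoc] using mul_mem hxy (inv_mem hy)
  have h2 : singleQuot i ⟨x⁻¹, inv_mem hx⟩ = (singleQuot i ⟨x, hx⟩)⁻¹ :=
    map_inv (singleQuot (R := R) i) ⟨x, hx⟩
  have h3 : singleQuot i ⟨x, hx⟩ * singleQuot i ⟨y * x⁻¹ * y⁻¹, hz⟩ =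
      singleQuot i ⟨x * (y * x⁻¹ * y⁻¹), hci⟩ :=
    (map_mul (singleQuot (R := R) i) ⟨x, hx⟩ ⟨_, hz⟩).symm
  have h4 : singleQuot j ⟨x * (y * x⁻¹ * y⁻¹), hcj⟩ * singleQuot j ⟨y, hy⟩ =
      singleQuot j ⟨x * y * x⁻¹, hxy⟩ := by
    refine (map_mul (singleQuot (R := R) j) ⟨_, hcj⟩ ⟨y, hy⟩).symm.trans
      (congrArg (singleQuot (R := R) j) (Subtype.ext ?_))
    simp [mul_assoc]
  rw [← h4, ← singleQuot_eq hci hcj, ← h3, ← h1, h2]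
  group

variable (R) in
/-- The product of the three blocks of a triple modulo the negligible ones. -/
def totalQuot : BlockQuot R →* F :=
  QuotientGroup.lift _ (total.comp (blockGroup R).subtype) fun _ hn => hn.1

@[simp] theorem totalQuot_mk (p : blockGroup R) : totalQuot R (QuotientGroup.mk p) = total p.1 :=
  rfl

theorem commClass_eq_of_mk_eq {p q : blockGroup R} (hp : total p.1 = 1)
    (h : (QuotientGroup.mk p : BlockQuot R) = QuotientGroup.mk q) :
    commClass R p.1 = commClass R q.1 := by
  have := (QuotientGroup.eq.1 h).2 p hp
  rw [← this, mul_inv_cancel_left]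

/-- The class of `[r, s]` in `I₃(F; R₁, R₂, R₃)`. -/
def commI (p : blockGroup R) (h : total p.1 = 1) : IThree R :=
  QuotientGroup.mk ⟨rcomm p.1.r p.1.s, rcomm_mem_tripleInter p.2 h⟩

theorem commI_eq {p q : blockGroup R} (hp : total p.1 = 1) (hq : total q.1 = 1)
    (h : (QuotientGroup.mk p : BlockQuot R) = QuotientGroup.mk q) : commI p hp = commI q hq := by
  refine QuotientGroup.eq.2 (Subgroup.mem_subgroupOf.2 ?_)
  exact QuotientGroup.eq.1 (commClass_eq_of_mk_eq hp h)

end BlockTriple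

/-! ### Crossed module identities -/

namespace FreeCrossed

variable {F : Type u} [Group F] {A : Type v} (r : A → F)

@[simp] theorem act_gen (g : F) (a : A) (w : F) : act r g (gen r a w) = gen r a (g * w) :=
  PresentedGroup.toGroup.of _

@[simp] theorem act_one (c : FreeCrossed r) : act r 1 c = c := by
  have : act r 1 = MonoidHom.id _ := PresentedGroup.ext fun p => by
    simpa [gen] using act_gen r 1 p.1 p.2
  exact DFunLike.congr_fun this c

theorem act_mul (g h : F) (c : FreeCrossed r) : act r (g * h) c = act r g (act r h c) := by
  have : act r (g * h) = (act r g).comp (act r h) := PresentedGroup.ext fun p => by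
    change act r (g * h) (gen r p.1 p.2) = act r g (act r h (gen r p.1 p.2))
    simp only [act_gen, mul_assoc]
  exact DFunLike.congr_fun this c

theorem boundary_act (g : F) (c : FreeCrossed r) :
    boundary r (act r g c) = g * boundary r c * g⁻¹ := by
  have : (boundary r).comp (act r g) = (MulAut.conj g).toMonoidHom.comp (boundary r) :=
    PresentedGroup.ext fun p => by
      change boundary r (act r g (gen r p.1 p.2)) = g * boundary r (gen r p.1 p.2) * g⁻¹
      simp only [act_gen, boundary_gen]
      group
  exact DFunLike.congr_fun this c

/-- A subgroup that contains all the `e_a^w` is everything. -/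
theorem mem_of_gen_mem (H : Subgroup (FreeCrossed r)) (h : ∀ a w, gen r a w ∈ H)
    (c : FreeCrossed r) : c ∈ H :=
  PresentedGroup.generated_by _ H (fun p => h p.1 p.2) c

/-- The Peiffer identity for arbitrary elements. -/
theorem act_boundary (c d : FreeCrossed r) : act r (boundary r c) d = c * d * c⁻¹ := by
  let H : Subgroup (FreeCrossed r) :=
    { carrier := {c | ∀ d, act r (boundary r c) d = c * d * c⁻¹}
      one_mem' := fun d => by simp
      mul_mem' := fun {x y} hx hy d => by
        rw [map_mul, act_mul, hy, hx]; group
      inv_mem' := fun {x} hx d => by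
        have := hx (act r (boundary r x⁻¹) d)
        rw [← act_mul, ← map_mul, mul_inv_cancel, map_one, act_one] at this
        conv_rhs => rw [this]
        simp [mul_assoc] }
  suffices h : c ∈ H from h d
  refine mem_of_gen_mem r H (fun a v d => ?_) c
  have : act r (boundary r (gen r a v)) = (MulAut.conj (gen r a v)).toMonoidHom :=
    PresentedGroup.ext fun p => by
      change act r _ (gen r p.1 p.2) = gen r a v * gen r p.1 p.2 * (gen r a v)⁻¹
      rw [act_gen, boundary_gen]
      exact (mul_inv_eq_one.1 (gen_peiffer r a p.1 v p.2)).symm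
  exact DFunLike.congr_fun this d

@[simp] theorem incl_gen (S : Set A) (a : S) (w : F) :
    incl r S (gen (fun a : S => r a) a w) = gen r a w :=
  PresentedGroup.toGroup.of _

theorem act_incl (S : Set A) (g : F) (c : FreeCrossed fun a : S => r a) :
    act r g (incl r S c) = incl r S (act _ g c) := by
  have : (act r g).comp (incl r S) = (incl r S).comp (act _ g) := PresentedGroup.ext fun p => by
    change act r g (incl r S (gen _ p.1 p.2)) = incl r S (act _ g (gen _ p.1 p.2))
    simp only [act_gen, incl_gen]
  exact DFunLike.congr_fun this c

/-- The kernel of the boundary map is central. -/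
theorem commute_of_boundary_eq_one {c : FreeCrossed r} (hc : boundary r c = 1)
    (d : FreeCrossed r) : c * d = d * c := by
  have := act_boundary r c d
  rw [hc, act_one] at this
  exact (eq_mul_inv_iff_mul_eq.1 this).symm

end FreeCrossed

namespace TriadData

variable {T : TriadData.{u}}

theorem act_mem_relSub {i : Fin 3} {c : T.C} (hc : c ∈ T.relSub i) (g : T.F) :
    FreeCrossed.act T.attach g c ∈ T.relSub i := by
  obtain ⟨c, rfl⟩ := hc
  exact ⟨_, (FreeCrossed.act_incl _ _ _ _).symm⟩

instance relSub_normal (i : Fin 3) : (T.relSub i).Normal :=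
  ⟨fun c hc d => by
    rw [← FreeCrossed.act_boundary]
    exact act_mem_relSub hc _⟩

theorem gen_mem_relSub {i : Fin 3} {a : T.Cell} (ha : a ∈ T.sub i) (w : T.F) :
    FreeCrossed.gen T.attach a w ∈ T.relSub i :=
  ⟨_, FreeCrossed.incl_gen T.attach (T.sub i) ⟨a, ha⟩ w⟩

/-- An element of the image of `π₂(Kᵢ, K¹)` with trivial boundary comes from `π₂(Kᵢ)`. -/
theorem mem_piTwoSub {i : Fin 3} {z : T.piTwo} (hz : z.1 ∈ T.relSub i) : z ∈ T.piTwoSub i := by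
  obtain ⟨c, hc⟩ := hz
  refine Subgroup.mem_subgroupOf.2 ⟨c, ?_, hc⟩
  have : T.bd z.1 = 1 := z.2
  rwa [← hc, FreeCrossed.boundary_incl] at this

theorem exists_terms (c : T.C) :
    ∃ l : List T.Term, (l.map Term.lift).prod = c := by
  let H : Subgroup T.C :=
    { carrier := {c | ∃ l : List T.Term, (l.map Term.lift).prod = c}
      one_mem' := ⟨[], rfl⟩
      mul_mem' := by
        rintro _ _ ⟨l, rfl⟩ ⟨l', rfl⟩
        exact ⟨l ++ l', by simp⟩
      inv_mem' := by
        rintro _ ⟨l, rfl⟩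
        refine ⟨(l.map Term.inv).reverse, ?_⟩
        rw [List.prod_inv_reverse, List.map_reverse, List.map_map, List.map_map]
        congr 3
        funext a
        simp [Term.lift, Term.inv] }
  exact FreeCrossed.mem_of_gen_mem _ H (fun a w => ⟨[⟨a, w, 1⟩], by simp [Term.lift]⟩) c

/-- Each 2-cell lies in one of the three subcomplexes, and its attaching element is trivial in the
fundamental groups of the subcomplexes that contain it. -/
structure IsCovered (T : TriadData.{u}) : Prop where
  attach_mem : ∀ {i a}, a ∈ T.sub i → T.attach a ∈ T.R i
  exists_mem : ∀ a, ∃ i, a ∈ T.sub i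

namespace IsCovered

open BlockTriple

variable (hT : T.IsCovered)
include hT

theorem conj_attach_mem {i : Fin 3} {a : T.Cell} (ha : a ∈ T.sub i) (w : T.F) :
    w * T.attach a * w⁻¹ ∈ T.R i :=
  (T.normal i).conj_mem _ (hT.attach_mem ha) w

/-- The homomorphism that sorts the terms of a sequence into blocks; it is well defined on
`π₂(K, K¹)` modulo the negligible triples, whatever blocks are chosen for the cells. -/
noncomputable def sort : T.C →* BlockQuot T.R :=
  PresentedGroup.toGroup
    (f := fun p : T.Cell × T.F => singleQuot (hT.exists_mem p.1).choose
      ⟨p.2 * T.attach p.1 * p.2⁻¹, hT.conj_attach_mem (hT.exists_mem p.1).choose_spec p.2⟩) (by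
    rintro _ ⟨a, b, v, w, rfl⟩
    have e : v * T.attach a * v⁻¹ * w * T.attach b * (v * T.attach a * v⁻¹ * w)⁻¹ =
        v * T.attach a * v⁻¹ * (w * T.attach b * w⁻¹) * (v * T.attach a * v⁻¹)⁻¹ := by group
    have hb := (hT.exists_mem b).choose_spec
    simp only [map_mul, map_inv, FreeGroup.lift_apply_of]
    rw [mul_inv_eq_one, singleQuot_conj _ _ (e ▸ hT.conj_attach_mem hb _)]
    congr 2
    exact e.symm)

theorem sort_gen {i : Fin 3} {a : T.Cell} (ha : a ∈ T.sub i) (w : T.F) :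
    hT.sort (FreeCrossed.gen T.attach a w) =
      singleQuot i ⟨w * T.attach a * w⁻¹, hT.conj_attach_mem ha w⟩ :=
  (PresentedGroup.toGroup.of _).trans (singleQuot_eq _ _)

theorem sort_incl (i : Fin 3) (c : FreeCrossed fun a : T.sub i => T.attach a) :
    ∃ h : FreeCrossed.boundary _ c ∈ T.R i,
      hT.sort (FreeCrossed.incl T.attach (T.sub i) c) = singleQuot i ⟨_, h⟩ := by
  have h : ∀ c, FreeCrossed.boundary (fun a : T.sub i => T.attach a) c ∈ T.R i :=
    FreeCrossed.mem_of_gen_mem _ ((T.R i).comap _) fun a w => by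
      rw [Subgroup.mem_comap, FreeCrossed.boundary_gen]
      exact hT.conj_attach_mem a.2 w
  have : hT.sort.comp (FreeCrossed.incl T.attach (T.sub i)) =
      (singleQuot i).comp ((FreeCrossed.boundary _).codRestrict (T.R i) h) :=
    PresentedGroup.ext fun p => by
      change hT.sort (FreeCrossed.incl T.attach (T.sub i) (FreeCrossed.gen _ p.1 p.2)) =
        singleQuot i ⟨FreeCrossed.boundary _ (FreeCrossed.gen _ p.1 p.2), _⟩
      rw [FreeCrossed.incl_gen, hT.sort_gen p.1.2]
      congr 2
      exact (FreeCrossed.boundary_gen _ _ _).symm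
  exact ⟨h c, DFunLike.congr_fun this c⟩

theorem sort_of_mem_relSub {i : Fin 3} {c : T.C} (hc : c ∈ T.relSub i) :
    ∃ h : T.bd c ∈ T.R i, hT.sort c = singleQuot i ⟨_, h⟩ := by
  obtain ⟨c, rfl⟩ := hc
  obtain ⟨h, e⟩ := hT.sort_incl i c
  have eb := FreeCrossed.boundary_incl T.attach (T.sub i) c
  refine ⟨eb ▸ h, e.trans ?_⟩
  congr 2
  exact eb.symm

theorem totalQuot_sort (c : T.C) : totalQuot T.R (hT.sort c) = T.bd c := by
  have : (totalQuot T.R).comp hT.sort = T.bd := PresentedGroup.ext fun p => by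
    obtain ⟨i, hi⟩ := hT.exists_mem p.1
    change totalQuot T.R (hT.sort (FreeCrossed.gen _ p.1 p.2)) =
      T.bd (FreeCrossed.gen _ p.1 p.2)
    rw [hT.sort_gen hi, singleQuot_apply, totalQuot_mk, total_single, FreeCrossed.boundary_gen]
  exact DFunLike.congr_fun this c

theorem total_out_sort (z : T.piTwo) : total (hT.sort z.1).out.1 = 1 := by
  rw [← totalQuot_mk, QuotientGroup.out_eq', hT.totalQuot_sort]
  exact z.2

theorem sort_eq_one {z : T.piTwo} (hz : z ∈ T.piTwoSum) : hT.sort z.1 = 1 := by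
  have : T.piTwoSum ≤ (hT.sort.comp T.piTwo.subtype).ker := iSup_le fun j z hz => by
    obtain ⟨c, hc, hcz⟩ := Subgroup.mem_map.1 (Subgroup.mem_subgroupOf.1 hz)
    obtain ⟨h, e⟩ := hT.sort_incl j c
    rw [MonoidHom.mem_ker, MonoidHom.comp_apply, Subgroup.coe_subtype, ← hcz, e,
      ← map_one (singleQuot (R := T.R) j)]
    exact congrArg _ (Subtype.ext hc)
  exact this hz

/-- The function `Λₓ`. -/
noncomputable def lambda : T.PiTwoQuot → T.I :=
  Quotient.lift (fun z : T.piTwo => commI (hT.sort z.1).out (hT.total_out_sort z)) fun z z' h => by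
    refine commI_eq _ _ ?_
    have h1 := hT.sort_eq_one (QuotientGroup.leftRel_apply.1 h)
    simp only [QuotientGroup.out_eq']
    simpa [inv_mul_eq_one] using h1

theorem lambda_mk (z : T.piTwo) (p : blockGroup T.R) (hp : total p.1 = 1)
    (h : hT.sort z.1 = QuotientGroup.mk p) : hT.lambda (QuotientGroup.mk z) = commI p hp :=
  commI_eq (hT.total_out_sort z) hp (by rw [QuotientGroup.out_eq', h])

theorem sort_lift {i : Fin 3} {a : T.Term} (ha : a.cell ∈ T.sub i) :
    ∃ h : a.val ∈ T.R i, hT.sort a.lift = singleQuot i ⟨_, h⟩ := by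
  rw [← Term.bd_lift]
  exact hT.sort_of_mem_relSub (zpow_mem (gen_mem_relSub ha _) _)

/-- The blocks of a divided sequence represent the class of the sequence. -/
theorem sort_blocks (l : List (Fin 3 × T.Term)) (hl : ∀ p ∈ l, p.2.cell ∈ T.sub p.1) :
    ∃ p : blockGroup T.R, (p.1.r, p.1.s, p.1.t) = blocks (l.map fun p => (p.1, p.2.val)) ∧
      hT.sort ((l.map Prod.snd).map Term.lift).prod = QuotientGroup.mk p := by
  induction l with
  | nil => exact ⟨1, rfl, map_one _⟩
  | cons x l ih =>
    obtain ⟨p, hp, hs⟩ := ih fun q hq => hl q (List.mem_cons_of_mem _ hq)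
    obtain ⟨i, a⟩ := x
    obtain ⟨ha, hsa⟩ := hT.sort_lift (hl (i, a) List.mem_cons_self)
    refine ⟨⟨single i a.val, single_mem ha⟩ * p, ?_, ?_⟩
    · simp only [List.map_cons, blocks, ← hp]
      fin_cases i <;> simp
    · simp only [List.map_cons, List.prod_cons, map_mul, hs, hsa]
      rfl

theorem lambda_isLambda : IsLambda hT.lambda := by
  intro c
  obtain ⟨p, hp, hs⟩ := hT.sort_blocks c.terms c.mem_sub
  have ht : total p.1 = 1 := by
    rw [← totalQuot_mk, ← hs, hT.totalQuot_sort]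
    exact (seqClass c.seq c.isIdentity).2
  have hr : p.1.r = c.r := congrArg Prod.fst hp
  have hs' : p.1.s = c.s := congrArg (fun q => q.2.1) hp
  have h : rcomm c.r c.s ∈ tripleInter T.R := by
    rw [← hr, ← hs']; exact rcomm_mem_tripleInter p.2 ht
  refine ⟨h, (hT.lambda_mk _ p ht hs).trans ?_⟩
  simp only [commI, hr, hs']

theorem cls_surjective : Function.Surjective (DividedSeq.cls (T := T)) := by
  intro a
  obtain ⟨z, rfl⟩ := QuotientGroup.mk_surjective a
  obtain ⟨l, hl⟩ := exists_terms z.1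
  have hmap : (l.map fun a => ((hT.exists_mem a.cell).choose, a)).map Prod.snd = l := by
    simp [Function.comp_def]
  have hid : IsIdentitySeq l := by
    have : T.bd z.1 = 1 := z.2
    rw [← hl, map_list_prod, List.map_map] at this
    rwa [IsIdentitySeq, ← (funext Term.bd_lift : (T.bd : T.C → T.F) ∘ Term.lift = Term.val)]
  refine ⟨⟨l.map fun a => ((hT.exists_mem a.cell).choose, a), ?_, hmap.symm ▸ hid⟩, ?_⟩
  · simp only [List.mem_map]
    rintro _ ⟨a, -, rfl⟩
    exact (hT.exists_mem a.cell).choose_spec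
  · refine congrArg QuotientGroup.mk (Subtype.ext ?_)
    simp only [seqClass, DividedSeq.seq, hmap, hl]

theorem isLambda_iff {Λ : T.PiTwoQuot → T.I} : IsLambda Λ ↔ Λ = hT.lambda := by
  refine ⟨fun h => funext fun a => ?_, fun h => h ▸ hT.lambda_isLambda⟩
  obtain ⟨c, rfl⟩ := hT.cls_surjective a
  obtain ⟨h1, e1⟩ := h c
  obtain ⟨h2, e2⟩ := hT.lambda_isLambda c
  rw [e1, e2]

end IsCovered

/-- Peiffer operations do not change the element of `π₂(K, K¹)` that a sequence represents. -/
theorem PeifferEquiv.prod_lift_eq {l l' : List T.Term} (h : PeifferEquiv l l') :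
    (l.map Term.lift).prod = (l'.map Term.lift).prod := by
  have conj : ∀ (c : T.C) (a : T.Term),
      (Term.conjBy (T.bd c) a).lift = c * a.lift * c⁻¹ := fun c a => by
    rw [← FreeCrossed.act_boundary]
    simp [Term.lift, Term.conjBy, map_zpow]
  induction h with
  | rel _ _ h =>
    cases h with
    | cancel l₁ l₂ a => simp [Term.lift, Term.inv]
    | exchRight l₁ l₂ a b =>
      have := conj b.lift⁻¹ a
      rw [map_inv, Term.bd_lift] at this
      simp [this, mul_assoc]
    | exchLeft l₁ l₂ a b =>
      have := conj a.lift b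
      rw [Term.bd_lift] at this
      simp [this, mul_assoc]
  | refl => rfl
  | symm _ _ _ ih => exact ih.symm
  | trans _ _ _ _ _ ih1 ih2 => exact ih1.trans ih2

end TriadData

/-! ### Morphisms from the sphere -/

namespace TriadData

namespace Hom

variable {T : TriadData.{u}} {T' : TriadData.{v}} {T'' : TriadData.{w}}

/-- The composite of two morphisms. -/
def comp (f' : Hom T' T'') (f : Hom T T') : Hom T T'' where
  g := f'.g.comp f.g
  φ := f'.φ.comp f.φ
  bd_φ c := by simp only [MonoidHom.comp_apply, f'.bd_φ, f.bd_φ]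
  φ_act x c := by simp only [MonoidHom.comp_apply, f'.φ_act, f.φ_act]
  φ_sub i := (f.φ_sub i).trans (Subgroup.comap_mono (f'.φ_sub i))
  g_R i := (f.g_R i).trans (Subgroup.comap_mono (f'.g_R i))

theorem mapI_comp (f' : Hom T' T'') (f : Hom T T') (a : T.I) :
    (f'.comp f).mapI a = f'.mapI (f.mapI a) := by
  obtain ⟨a, rfl⟩ := QuotientGroup.mk_surjective a
  rfl

theorem q_comp (f : Hom T T') (f₀ : Hom sphereData T) :
    (f.comp f₀).q = f.mapPiTwoQuot f₀.q := rfl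

/-- Where a morphism from the sphere sends the `i`-th 2-cell. -/
def cellImage (f : Hom sphereData T) (i : Fin 3) : T.C := f.φ (FreeCrossed.gen sphereRelator i 1)

theorem cellImage_mem (f : Hom sphereData T) (i : Fin 3) : f.cellImage i ∈ T.relSub i :=
  f.φ_sub i (gen_mem_relSub (T := sphereData) rfl 1)

theorem bd_cellImage (f : Hom sphereData T) (i : Fin 3) :
    T.bd (f.cellImage i) = f.g (sphereRelator i) := by
  refine (f.bd_φ _).trans (congrArg _ ?_)
  refine (FreeCrossed.boundary_gen sphereRelator i 1).trans ?_
  rw [one_mul, inv_one, mul_one]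

theorem mapPiTwo_sphereGen (f : Hom sphereData T) :
    (f.mapPiTwo sphereGen).1 = f.cellImage 0 * f.cellImage 1 * f.cellImage 2 := by
  exact (map_mul f.φ _ _).trans (congrArg (· * _) (map_mul f.φ _ _))

/-- The images of the `i`-th cell under two morphisms with the same underlying homomorphism differ
by an element of `π₂(Kᵢ)`, which is central. -/
theorem q_eq_of_g_eq (f f' : Hom sphereData T) (h : f.g = f'.g) : f.q = f'.q := by
  have hz : ∀ i, ∃ z : T.piTwo, z ∈ T.piTwoSub i ∧ f'.cellImage i = f.cellImage i * z.1 := by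
    intro i
    refine ⟨⟨(f.cellImage i)⁻¹ * f'.cellImage i, ?_⟩, mem_piTwoSub ?_, by simp⟩
    · rw [MonoidHom.mem_ker, map_mul, map_inv, bd_cellImage, bd_cellImage, h, inv_mul_cancel]
    · exact mul_mem (inv_mem (f.cellImage_mem i)) (f'.cellImage_mem i)
  choose z hz he using hz
  refine QuotientGroup.eq.2 ?_
  have e : (f.mapPiTwo sphereGen)⁻¹ * f'.mapPiTwo sphereGen = z 0 * z 1 * z 2 := by
    rw [inv_mul_eq_iff_eq_mul]
    apply Subtype.ext
    have c : ∀ i, ∀ d : T.C, (z i).1 * d = d * (z i).1 := fun i =>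
      FreeCrossed.commute_of_boundary_eq_one _ (z i).2
    have c01 : ∀ x₀ x₁ x₂ : T.C, x₀ * (z 0).1 * (x₁ * (z 1).1) * (x₂ * (z 2).1) =
        x₀ * x₁ * x₂ * ((z 0).1 * (z 1).1 * (z 2).1) := fun x₀ x₁ x₂ => by
      rw [mul_assoc x₀, ← mul_assoc (z 0).1, c 0 x₁]
      simp only [mul_assoc]
      rw [← mul_assoc (z 1).1, c 1 x₂, mul_assoc, ← mul_assoc (z 0).1, c 0 x₂, mul_assoc]
    simp only [Subgroup.coe_mul, mapPiTwo_sphereGen, he]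
    exact c01 _ _ _
  rw [e]
  have hle : ∀ i, z i ∈ T.piTwoSum := fun i => le_iSup T.piTwoSub i (hz i)
  exact mul_mem (mul_mem (hle 0) (hle 1)) (hle 2)

/-- The class of `[x₁, x₂]` is sent to `Λₓ (q f)`: the triple `(∂ φ s₁, ∂ φ s₂, ∂ φ s₃)` represents
`φ (s₁ s₂ s₃)`. -/
theorem mapI_hopfClass (hT : T.IsCovered) (f : Hom sphereData T) :
    f.mapI hopfClass = hT.lambda f.q := by
  obtain ⟨h0, e0⟩ := hT.sort_of_mem_relSub (f.cellImage_mem 0)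
  obtain ⟨h1, e1⟩ := hT.sort_of_mem_relSub (f.cellImage_mem 1)
  obtain ⟨h2, e2⟩ := hT.sort_of_mem_relSub (f.cellImage_mem 2)
  let p : BlockTriple.blockGroup T.R := ⟨⟨_, _, _⟩, h0, h1, h2⟩
  have hp : BlockTriple.total p.1 = 1 := by
    have := (f.mapPiTwo sphereGen).2
    rwa [MonoidHom.mem_ker, mapPiTwo_sphereGen, map_mul, map_mul] at this
  have hs : hT.sort (f.mapPiTwo sphereGen).1 = QuotientGroup.mk p := by
    rw [mapPiTwo_sphereGen, map_mul, map_mul, e0, e1, e2]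
    simp only [BlockTriple.singleQuot_apply, ← QuotientGroup.mk_mul]
    exact congrArg _ (Subtype.ext (BlockTriple.eq_single_mul p.1).symm)
  refine Eq.trans ?_ (hT.lambda_mk _ p hp hs).symm
  refine congrArg QuotientGroup.mk (Subtype.ext ?_)
  refine (map_rcomm f.g _ _).trans ?_
  change _ = rcomm (T.bd _) (T.bd _)
  rw [bd_cellImage, bd_cellImage]
  rfl

section OfCells

variable (x : Fin 3 → T.C)

/-- The homomorphism `π₁(L¹) → π₁(K¹)` that sends the boundary of the `i`-th 2-cell of the sphere to
`∂ (x i)`, for `i = 1, 2`. -/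
def sphereLift : FreeGroup (Fin 2) →* T.F := FreeGroup.lift ![T.bd (x 0), T.bd (x 1)]

variable (h1 : T.bd (x 0 * x 1 * x 2) = 1)
include h1

theorem sphereLift_relator (i : Fin 3) : sphereLift x (sphereRelator i) = T.bd (x i) := by
  have e : T.bd (x 2) = (T.bd (x 1))⁻¹ * (T.bd (x 0))⁻¹ := by
    rw [map_mul, map_mul, mul_eq_one_iff_inv_eq] at h1
    rw [← h1, mul_inv_rev]
  fin_cases i
  · simp [sphereLift, sphereRelator]
  · simp [sphereLift, sphereRelator]
  · simp [sphereLift, sphereRelator, e]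

/-- The map of crossed modules that sends the `i`-th 2-cell of the sphere to `x i`. -/
def sphereCrossedLift : FreeCrossed sphereRelator →* T.C :=
  PresentedGroup.toGroup
    (f := fun p : Fin 3 × FreeGroup (Fin 2) =>
      FreeCrossed.act T.attach (sphereLift x p.2) (x p.1)) (by
    rintro _ ⟨a, b, v, w, rfl⟩
    simp only [map_mul, map_inv, FreeGroup.lift_apply_of]
    rw [mul_inv_eq_one, ← FreeCrossed.act_boundary, FreeCrossed.boundary_act,
      ← FreeCrossed.act_mul, ← sphereLift_relator x h1 a])

theorem sphereCrossedLift_gen (i : Fin 3) (w : FreeGroup (Fin 2)) :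
    sphereCrossedLift x h1 (FreeCrossed.gen sphereRelator i w) =
      FreeCrossed.act T.attach (sphereLift x w) (x i) :=
  PresentedGroup.toGroup.of _

theorem bd_sphereCrossedLift (c : FreeCrossed sphereRelator) :
    T.bd (sphereCrossedLift x h1 c) = sphereLift x (FreeCrossed.boundary sphereRelator c) := by
  have : T.bd.comp (sphereCrossedLift x h1) =
      (sphereLift x).comp (FreeCrossed.boundary sphereRelator) := PresentedGroup.ext fun p => by
    change T.bd (sphereCrossedLift x h1 (FreeCrossed.gen sphereRelator p.1 p.2)) =
      sphereLift x (FreeCrossed.boundary sphereRelator (FreeCrossed.gen sphereRelator p.1 p.2))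
    rw [sphereCrossedLift_gen, FreeCrossed.boundary_act, FreeCrossed.boundary_gen,
      ← sphereLift_relator x h1 p.1, map_mul, map_mul, map_inv]
  exact DFunLike.congr_fun this c

theorem sphereCrossedLift_act (y : FreeGroup (Fin 2)) (c : FreeCrossed sphereRelator) :
    sphereCrossedLift x h1 (FreeCrossed.act sphereRelator y c) =
      FreeCrossed.act T.attach (sphereLift x y) (sphereCrossedLift x h1 c) := by
  have : (sphereCrossedLift x h1).comp (FreeCrossed.act sphereRelator y) =
      (FreeCrossed.act T.attach (sphereLift x y)).comp (sphereCrossedLift x h1) :=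
    PresentedGroup.ext fun p => by
      change sphereCrossedLift x h1
          (FreeCrossed.act sphereRelator y (FreeCrossed.gen sphereRelator p.1 p.2)) =
        FreeCrossed.act T.attach _ (sphereCrossedLift x h1 (FreeCrossed.gen sphereRelator p.1 p.2))
      rw [FreeCrossed.act_gen, sphereCrossedLift_gen, sphereCrossedLift_gen, ← FreeCrossed.act_mul,
        map_mul]
  exact DFunLike.congr_fun this c

theorem sphereCrossedLift_incl_mem {i : Fin 3} (hx : x i ∈ T.relSub i)
    (c : FreeCrossed fun a : ({i} : Set (Fin 3)) => sphereRelator a) :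
    sphereCrossedLift x h1 (FreeCrossed.incl sphereRelator {i} c) ∈ T.relSub i := by
  refine FreeCrossed.mem_of_gen_mem _
    (((T.relSub i).comap (sphereCrossedLift x h1)).comap (FreeCrossed.incl sphereRelator {i}))
    (fun a w => ?_) c
  rw [Subgroup.mem_comap, FreeCrossed.incl_gen, Subgroup.mem_comap, sphereCrossedLift_gen,
    Set.mem_singleton_iff.1 a.2]
  exact act_mem_relSub hx _

theorem normalClosure_sphereRelator_le (hT : T.IsCovered) {i : Fin 3} (hx : x i ∈ T.relSub i) :
    Subgroup.normalClosure {sphereRelator i} ≤ (T.R i).comap (sphereLift x) := by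
  refine Subgroup.normalClosure_le_normal (Set.singleton_subset_iff.2 ?_)
  rw [SetLike.mem_coe, Subgroup.mem_comap, sphereLift_relator x h1]
  exact (hT.sort_of_mem_relSub hx).1

/-- The morphism from the sphere that sends the `i`-th 2-cell to a given `x i` in the image of
`π₂(Kᵢ, K¹)`. -/
def ofCells (hT : T.IsCovered) (hx : ∀ i, x i ∈ T.relSub i) : Hom sphereData T where
  g := sphereLift x
  φ := sphereCrossedLift x h1
  bd_φ := bd_sphereCrossedLift x h1
  φ_act := sphereCrossedLift_act x h1
  φ_sub i := by
    rintro _ ⟨c, rfl⟩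
    exact sphereCrossedLift_incl_mem x h1 (hx i) c
  g_R i := normalClosure_sphereRelator_le x h1 hT (hx i)

theorem cellImage_ofCells (hT : T.IsCovered) (hx : ∀ i, x i ∈ T.relSub i) (i : Fin 3) :
    (ofCells x h1 hT hx).cellImage i = x i :=
  (sphereCrossedLift_gen x h1 i 1).trans (by rw [map_one, FreeCrossed.act_one])

end OfCells

/-- Every element of `π₂(K)` is a product of three elements of the images of the `π₂(Kᵢ, K¹)`, hence
comes from a morphism from the sphere. -/
theorem q_surjective (hT : T.IsCovered) : Function.Surjective (Hom.q (T := T)) := by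
  intro a
  obtain ⟨z, rfl⟩ := QuotientGroup.mk_surjective a
  have htop : z.1 ∈ (T.relSub 0 ⊔ T.relSub 1) ⊔ T.relSub 2 := by
    refine FreeCrossed.mem_of_gen_mem _ _ (fun a w => ?_) z.1
    obtain ⟨i, hi⟩ := hT.exists_mem a
    have := gen_mem_relSub hi w
    fin_cases i
    · exact Subgroup.mem_sup_left (Subgroup.mem_sup_left this)
    · exact Subgroup.mem_sup_left (Subgroup.mem_sup_right this)
    · exact Subgroup.mem_sup_right this
  obtain ⟨y, hy, x2, hx2, hz⟩ := Subgroup.mem_sup_of_normal_right.1 htop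
  obtain ⟨x0, hx0, x1, hx1, rfl⟩ := Subgroup.mem_sup_of_normal_right.1 hy
  have hx : ∀ i, (![x0, x1, x2] : Fin 3 → T.C) i ∈ T.relSub i := by
    intro i
    fin_cases i
    exacts [hx0, hx1, hx2]
  have h1 : T.bd ((![x0, x1, x2] : Fin 3 → T.C) 0 * (![x0, x1, x2] : Fin 3 → T.C) 1 *
      (![x0, x1, x2] : Fin 3 → T.C) 2) = 1 := (congrArg T.bd hz).trans z.2
  refine ⟨ofCells ![x0, x1, x2] h1 hT hx, congrArg QuotientGroup.mk (Subtype.ext ?_)⟩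
  rw [mapPiTwo_sphereGen, cellImage_ofCells, cellImage_ofCells, cellImage_ofCells]
  exact hz

end Hom

/-! ### The group `I₃` of the sphere -/

/-- Modulo `[R₁, R₂ ∩ R₃] [R₂, R₃ ∩ R₁] [R₃, R₁ ∩ R₂]` the commutator `[x₁, x₂]` commutes with
`x₁ ∈ R₁` and `x₂ ∈ R₂`, hence is central. Factoring it out as well makes `F(x₁, x₂)` abelian,
so that an element with exponent sums `0`, such as an element of `R₁ ∩ R₂`, becomes trivial. -/
theorem sphereComm_zpow_of_mem_tripleInter {y : FreeGroup (Fin 2)}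
    (hy : y ∈ tripleInter sphereData.R) :
    ∃ n : ℤ, (sphereComm ^ n)⁻¹ * y ∈ tripleComm sphereData.R := by
  let J : Subgroup (FreeGroup (Fin 2)) := tripleComm sphereData.R
  have hJ : J.Normal := tripleComm_normal sphereData.R
  let π : FreeGroup (Fin 2) →* FreeGroup (Fin 2) ⧸ J := QuotientGroup.mk' J
  have hR : ∀ i, sphereRelator i ∈ sphereData.R i := fun i => Subgroup.subset_normalClosure rfl
  -- The commutator becomes central modulo `J`.
  have hcen : ∀ v, Commute (π v) (π sphereComm) := by
    intro v
    have : v ∈ (Subgroup.centralizer {π sphereComm}).comap π := by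
      have htop : Subgroup.closure (Set.range (FreeGroup.of : Fin 2 → _)) ≤
          (Subgroup.centralizer {π sphereComm}).comap π := by
        rw [Subgroup.closure_le]
        rintro _ ⟨i, rfl⟩
        refine Subgroup.mem_centralizer_singleton_iff.2 ?_
        fin_cases i
        · exact (commute_tripleInter (R := sphereData.R) (hR 0) sphereComm_mem).eq
        · exact (commute_tripleInter (R := sphereData.R) (hR 1) sphereComm_mem).eq
      exact htop (by rw [FreeGroup.closure_range_of]; trivial)
    exact Subgroup.mem_centralizer_singleton_iff.1 this
  have hZn : (Subgroup.zpowers (π sphereComm)).Normal := by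
    refine ⟨?_⟩
    rintro _ ⟨n, rfl⟩ g
    obtain ⟨v, rfl⟩ := QuotientGroup.mk'_surjective J g
    refine ⟨n, ?_⟩
    have := ((hcen v).zpow_right n).eq
    change _ = π v * π sphereComm ^ n * (π v)⁻¹
    rw [this, mul_inv_cancel_right]
  let ρ : FreeGroup (Fin 2) →* (FreeGroup (Fin 2) ⧸ J) ⧸ Subgroup.zpowers (π sphereComm) :=
    (QuotientGroup.mk' _).comp π
  have hρ : Commute (ρ (FreeGroup.of 0)) (ρ (FreeGroup.of 1)) := by
    have h1 : ρ (rcomm (FreeGroup.of 0) (FreeGroup.of 1)) = 1 :=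
      (QuotientGroup.eq_one_iff _).2 (Subgroup.mem_zpowers _)
    rw [map_rcomm, rcomm, mul_assoc, mul_assoc, inv_mul_eq_one, eq_inv_mul_iff_mul_eq]
      at h1
    exact h1.symm
  let exp : FreeGroup (Fin 2) →* Fin 2 → Multiplicative ℤ :=
    FreeGroup.lift fun i => Pi.mulSingle i (Multiplicative.ofAdd 1)
  -- Modulo the commutator, an element is determined by its two exponent sums.
  have hexp : ∀ v, ρ v =
      ρ (FreeGroup.of 0) ^ (exp v 0).toAdd * ρ (FreeGroup.of 1) ^ (exp v 1).toAdd := by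
    intro v
    induction v using FreeGroup.induction_on with
    | C1 => simp
    | of i => fin_cases i <;> simp [exp]
    | inv_of i h =>
      rw [map_inv, h, mul_inv_rev]
      simp only [map_inv, Pi.inv_apply, toAdd_inv, zpow_neg]
      exact ((hρ.zpow_zpow _ _).inv_inv).eq.symm
    | mul a b ha hb =>
      rw [map_mul, ha, hb]
      simp only [map_mul, Pi.mul_apply, toAdd_mul, zpow_add]
      have := (hρ.zpow_zpow (exp b 0).toAdd (exp a 1).toAdd).eq
      simp only [mul_assoc]
      rw [← mul_assoc (_ ^ (exp a 1).toAdd), ← this]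
      simp only [mul_assoc]
  have hsum : ∀ i j : Fin 2, i ≠ j → ∀ v ∈ Subgroup.normalClosure {FreeGroup.of i},
      exp v j = 1 := by
    intro i j hij v hv
    have : Subgroup.normalClosure {FreeGroup.of i} ≤ ((Pi.evalMonoidHom _ j).comp exp).ker := by
      refine Subgroup.normalClosure_le_normal (Set.singleton_subset_iff.2 ?_)
      change exp (FreeGroup.of i) j = 1
      simp [exp, hij.symm]
    exact this hv
  have h0 : exp y 1 = 1 := hsum 0 1 (by decide) y hy.1.1
  have h1 : exp y 0 = 1 := hsum 1 0 (by decide) y hy.1.2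
  have hy1 : ρ y = 1 := by rw [hexp, h0, h1]; simp
  obtain ⟨n, hn⟩ := (QuotientGroup.eq_one_iff _).1 hy1
  refine ⟨n, ?_⟩
  have hn' : π (sphereComm ^ n) = π y := (map_zpow π _ _).trans hn
  exact QuotientGroup.eq.1 hn'

/-- `I₃` of the sphere is generated by the class of `[x₁, x₂]`. -/
theorem exists_hopfClass_zpow (α : sphereData.I) : ∃ n : ℤ, α = hopfClass ^ n := by
  obtain ⟨⟨y, hy⟩, rfl⟩ := QuotientGroup.mk_surjective α
  obtain ⟨n, hn⟩ := sphereComm_zpow_of_mem_tripleInter hy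
  exact ⟨n, Eq.symm (QuotientGroup.eq.2 (Subgroup.mem_subgroupOf.2 hn))⟩

/-! ### Induced functions -/

variable {T : TriadData.{u}}

theorem mapI_eq_zpow (hT : T.IsCovered) {α : sphereData.I} {n : ℤ} (hα : α = hopfClass ^ n)
    (f : Hom sphereData T) : f.mapI α = hT.lambda f.q ^ n := by
  rw [hα, map_zpow, Hom.mapI_hopfClass hT]

theorem IsCovered.existsUnique_isInduced (hT : T.IsCovered) (α : sphereData.I) :
    ∃! αs : T.PiTwoQuot → T.I, IsInduced α αs := by
  obtain ⟨n, hn⟩ := exists_hopfClass_zpow α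
  refine ⟨fun a => hT.lambda a ^ n, fun f => (mapI_eq_zpow hT hn f).symm, fun αs h => ?_⟩
  funext a
  obtain ⟨f, rfl⟩ := Hom.q_surjective hT a
  rw [h f, mapI_eq_zpow hT hn]

theorem IsCovered.isInduced_hopfClass_iff (hT : T.IsCovered) {Λ : T.PiTwoQuot → T.I} :
    IsInduced hopfClass Λ ↔ Λ = hT.lambda :=
  ⟨fun h => (hT.existsUnique_isInduced hopfClass).unique h fun f => (Hom.mapI_hopfClass hT f).symm,
    fun h f => h ▸ (Hom.mapI_hopfClass hT f).symm⟩

end TriadData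

/-! ### Attaching loops -/

open RelCWComplex in
theorem Topology.RelCWComplex.Subcomplex.exists_mem_of_iUnion_eq {X : Type u}
    [TopologicalSpace X] [T2Space X] [CWComplex (Set.univ : Set X)] {ι : Type*}
    (E : ι → Subcomplex (Set.univ : Set X)) (hE : ⋃ i, (E i : Set X) = Set.univ) {n : ℕ}
    (e : cell (Set.univ : Set X) n) : ∃ i, e ∈ (E i).I n := by
  obtain ⟨x, hx⟩ := openCell_nonempty (C := (Set.univ : Set X)) n e
  obtain ⟨i, hi⟩ := Set.mem_iUnion.1 (hE.symm ▸ Set.mem_univ x)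
  refine ⟨i, ?_⟩
  by_contra h
  exact ((E i).disjoint_openCell_subcomplex_of_not_mem h).notMem_of_mem_left hx hi

namespace CoveredTwoComplex

open RelCWComplex

variable (K : CoveredTwoComplex.{u})

/-- The characteristic map of a 2-cell of `Kᵢ`, as a map into `Kᵢ`. -/
noncomputable def cellMap {i : Fin 3} {e : cell (Set.univ : Set K.X) 2} (he : e ∈ (K.sub i).I 2) :
    C(closedBall (0 : Fin 2 → ℝ) 1, (K.sub i : Set K.X)) where
  toFun x := ⟨RelCWComplex.map 2 e x,
    (K.sub i).closedCell_subset_of_mem he ⟨x, x.2, rfl⟩⟩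
  continuous_toFun := (continuousOn_iff_continuous_domRestrict.1
    (RelCWComplex.continuousOn 2 e)).subtype_mk _

/-- The loop around the boundary of the square, in the square. -/
noncomputable def squarePath :
    Path (⟨squareLoop 0, sphere_subset_closedBall (squareLoop_mem 0)⟩ :
      closedBall (0 : Fin 2 → ℝ) 1)
      ⟨squareLoop 0, sphere_subset_closedBall (squareLoop_mem 0)⟩ where
  toFun t := ⟨squareLoop t, sphere_subset_closedBall (squareLoop_mem t)⟩
  continuous_toFun := (squareLoop_continuous.comp continuous_subtype_val).subtype_mk _
  source' := by simp
  target' := by simp [squareLoop_one]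

/-- The attaching loop of a 2-cell of `Kᵢ` bounds a disc in `Kᵢ`. -/
theorem attachLoop_homotopic {i : Fin 3} {e : cell (Set.univ : Set K.X) 2}
    (he : e ∈ (K.sub i).I 2) :
    ((attachLoop e).map (K.inclusion i).continuous).Homotopic (Path.refl _) := by
  have : ContractibleSpace (closedBall (0 : Fin 2 → ℝ) 1) :=
    (convex_closedBall 0 1).contractibleSpace ⟨0, by simp⟩
  exact (SimplyConnectedSpace.paths_homotopic squarePath (Path.refl _)).map (K.cellMap he)

theorem attach_mem {i : Fin 3} {e : cell (Set.univ : Set K.X) 2} (he : e ∈ (K.sub i).I 2) :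
    K.attach e ∈ (FundamentalGroup.map (K.inclusion i) K.base).ker := by
  have h : Path.Homotopic.Quotient.mk ((attachLoop e).map (K.inclusion i).continuous) =
      Path.Homotopic.Quotient.refl _ := Quotient.sound (K.attachLoop_homotopic he)
  change Path.Homotopic.Quotient.mk
    (((K.tail e).trans (attachLoop e)).trans (K.tail e).symm |>.map (K.inclusion i).continuous) =
      Path.Homotopic.Quotient.refl _
  rw [Path.map_trans, Path.map_trans, ← Path.map_symm, Path.Homotopic.Quotient.mk_trans,
    Path.Homotopic.Quotient.mk_trans, h, Path.Homotopic.Quotient.mk_symm]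
  simp

theorem data_isCovered : K.data.IsCovered where
  attach_mem ha := K.attach_mem ha
  exists_mem := Subcomplex.exists_mem_of_iUnion_eq K.sub K.union_eq

end CoveredTwoComplex

/-! ### The functions `Λₓ` and `α_*` of a covered 2-complex -/

open TriadData in
theorem mainTheorem1 (K : CoveredTwoComplex.{u}) :
    (∀ c c' : DividedSeq K.data, PeifferEquiv c.seq c'.seq →
      ∃ x : K.data.I, c.IsCommClass x ∧ c'.IsCommClass x) ∧
    (∃! Λ : K.data.PiTwoQuot → K.data.I, IsLambda Λ) ∧
    (∀ f f' : Hom sphereData K.data, f.g = f'.g → f.q = f'.q) ∧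
    (∀ α : sphereData.I, ∃! αs : K.data.PiTwoQuot → K.data.I, IsInduced α αs) ∧
    (∀ Λ : K.data.PiTwoQuot → K.data.I, IsLambda Λ ↔ IsInduced hopfClass Λ) ∧
    (∀ (L : CoveredTwoComplex.{v}) (φ : Hom K.data L.data) (α : sphereData.I)
      (αK : K.data.PiTwoQuot → K.data.I) (αL : L.data.PiTwoQuot → L.data.I),
      IsInduced α αK → IsInduced α αL →
        ∀ a, αL (φ.mapPiTwoQuot a) = φ.mapI (αK a)) := by
  have hK := K.data_isCovered
  refine ⟨fun c c' h => ?_, ⟨hK.lambda, hK.lambda_isLambda, fun Λ h => hK.isLambda_iff.1 h⟩,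
    Hom.q_eq_of_g_eq, hK.existsUnique_isInduced,
    fun Λ => hK.isLambda_iff.trans hK.isInduced_hopfClass_iff.symm, ?_⟩
  · have e : c.cls = c'.cls := congrArg QuotientGroup.mk (Subtype.ext h.prod_lift_eq)
    exact ⟨_, hK.lambda_isLambda c, e ▸ hK.lambda_isLambda c'⟩
  · intro L φ α αK αL hαK hαL a
    obtain ⟨f, rfl⟩ := Hom.q_surjective hK a
    rw [hαK f, ← Hom.q_comp, hαL, Hom.mapI_comp]
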